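/- **Energy bound.** Let $a=(a_{ij})$ be the symmetric adjacency matrix, with $a_{ij}\ge 0$, of a weighted graph on the vertices $1,\dots,n$ (identified with $n$ qubits). Let $C=\frac12\sum_{i<j}a_{ij}(1-Z_iZ_j)$ be the Max-Cut cost, as a function on $\{-1,1\}^n$ and, with $Z_i$ the Pauli operator, as an operator on $n$ qubits; let $C_{\max}=\max_{Z\in\{-1,1\}^n}C$ and $C_{\mathrm{avg}}=\mathrm{tr}(C)/2^n$. *Circuits.* Let $p\in[0,1]$, let $\tau_0=\mathrm{id}$ and $\tau_1(X)=\mathrm{tr}(X)\,I/2$ be maps on one-qubit operators, and let $\mathcal N=\big((1-p)\tau_0+p\,\tau_1\big)^{\otimes n}$ be a layer of depolarizing noise. A layer of gates is given by a set of disjoint pairs of qubits, and its unitary is the tensor product of two-qubit unitaries on these pairs (and of the identity on the other qubits). For a sequence of layers $S=(S_1,\dots,S_m)$ with unitaries $V_1,\dots,V_m$, write $\mathcal V_t(X)=V_tXV_t^\dagger$; the noisy entangle/uncompute circuit of depth $D=2m$ is $$\Phi=(\mathcal N\mathcal V_1^\dagger)(\mathcal N\mathcal V_2^\dagger)\cdots(\mathcal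 N\mathcal V_m^\dagger)(\mathcal N\mathcal V_m)\cdots(\mathcal N\mathcal V_2)(\mathcal N\mathcal V_1),$$ or, in a second convention, this channel preceded by one more layer $\mathcal N$. An architecture $\mathcal A$ is a probability law for the sequence $S$ (a point mass for a fixed arrangement of the gates, such as 1D and 2D brickwork circuits with periodic boundary conditions; the uniform law on sequences of perfect matchings for the nonlocal architecture). It is translationally invariant if for all qubits $i,j$ there is a permutation of the qubits that maps $i$ to $j$ and leaves the law of $S$ invariant. Let $\Phi^{\mathcal A}_{\mathrm{avg}}$ be the average of $\Phi$ over $S$ and over independent Haar-random two-qubit gates in $U(4)$ on all the pairs of all layers. *Claim.* In either convention, for every translationally invariant architecture $\mathcal A$, there is exactly one probability distribution $\pi$ on $\{0,1\}^n$ with $$\Phi^{\mathcal A}_{\mathrm{avg}}=\sum_{\vec j\in\{0,1\}^n}\pi(\vec j)\,\tau_{j_1}\otimes\cdots\otimes\tau_{j_n}.$$ Let $\langle q\rangle=\sum_{\vec j}\pi(\vec j)\,(j_1+\dots+j_n)$ be the corresponding expected number of depolarized qubits. Then for every density matrix $\rho$ on the $n$ qubits $$\mathrm{tr}\big(C\,\Phi^{\mathcal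 A}_{\mathrm{avg}}(\rho)\big)\le\tfrac12\Big(1-\tfrac{\langle q\rangle}{n}\Big)\Big(2-\tfrac{\langle q\rangle}{n}\Big)C_{\max}+\Big(1-\big(1-\tfrac{\langle q\rangle}{n}\big)^2\Big)C_{\mathrm{avg}}.$$ -/

import Mathlib

open scoped ComplexOrder

noncomputable section

namespace NoisyEcho

/-! ### Haar measure on two-qubit gates -/

/-- Two-qubit gates: the unitary group `U(4)`, acting on `ℂ² ⊗ ℂ²`. -/
abbrev Gate : Type := Matrix.unitaryGroup (Fin 2 × Fin 2) ℂ

instance : CompactSpace Gate := by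
  have hc : IsClosed
      {U : Matrix (Fin 2 × Fin 2) (Fin 2 × Fin 2) ℂ | U * star U = 1} :=
    isClosed_eq (by fun_prop) continuous_const
  have hK : IsCompact (Set.pi Set.univ fun _ : Fin 2 × Fin 2 =>
      Set.pi Set.univ fun _ : Fin 2 × Fin 2 => Metric.closedBall (0 : ℂ) 1) :=
    isCompact_univ_pi fun _ => isCompact_univ_pi fun _ => isCompact_closedBall 0 1
  refine isCompact_iff_compactSpace.mp (hK.of_isClosed_subset ?_ ?_)
  · have h : (Matrix.unitaryGroup (Fin 2 × Fin 2) ℂ : Set (Matrix _ _ ℂ)) =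
        {U : Matrix (Fin 2 × Fin 2) (Fin 2 × Fin 2) ℂ | U * star U = 1} :=
      Set.ext fun U => Matrix.mem_unitaryGroup_iff
    exact h ▸ hc
  · intro U hU i _ j _
    simpa using entry_norm_bound_of_unitary hU i j

instance : MeasurableSpace Gate := borel _

instance : BorelSpace Gate := ⟨rfl⟩

/-- The Haar probability measure on `U(4)`. -/
def haarGate : MeasureTheory.Measure Gate := MeasureTheory.Measure.haarMeasure ⊤

/-! ### Operators and maps on `n` qubits -/

/-- Operators on `n` qubits, in the computational basis. -/
abbrev Op (n : ℕ) : Type := Matrix (Fin n → Fin 2) (Fin n → Fin 2) ℂ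

/-- Linear maps on one-qubit operators. -/
abbrev QubitMap : Type :=
  Matrix (Fin 2) (Fin 2) ℂ →ₗ[ℂ] Matrix (Fin 2) (Fin 2) ℂ

/-- Tensor product of one-qubit linear maps, given by its values on the matrix units
`|x'⟩⟨y'| = ⨂ᵢ |x'ᵢ⟩⟨y'ᵢ|`. -/
def tensorMap {n : ℕ} (K : Fin n → QubitMap) (X : Op n) : Op n :=
  Matrix.of fun x y =>
    ∑ x', ∑ y', X x' y' * ∏ i, K i (Matrix.single (x' i) (y' i) 1) (x i) (y i)

/-- Replacement of a qubit by the maximally mixed state: `X ↦ tr(X) I/2`. -/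
def erase : QubitMap :=
  (Matrix.traceLinearMap (Fin 2) ℂ ℂ).smulRight ((1 / 2 : ℂ) • 1)

/-- One-qubit depolarizing noise of strength `p`: `X ↦ (1 - p) X + p tr(X) I/2`. -/
def depolarizing (p : ℝ) : QubitMap := (1 - p : ℂ) • LinearMap.id + (p : ℂ) • erase

/-- A layer of independent depolarizing noise on all qubits. -/
def noiseLayer {n : ℕ} (p : ℝ) : Op n → Op n := tensorMap fun _ => depolarizing p

/-- The map that erases the qubits `i` with `j i = true` and leaves the other ones unchanged. -/
def errorMap {n : ℕ} (j : Fin n → Bool) : Op n → Op n :=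
  tensorMap fun i => if j i then erase else LinearMap.id

/-! ### Circuits -/

/-- A layer of two-qubit gates is specified by the set of disjoint pairs of qubits that interact,
here an involution `σ`: qubit `i` interacts with `σ i` if `σ i ≠ i`, and is idle otherwise. -/
abbrev Layer (n : ℕ) : Type := {σ : Equiv.Perm (Fin n) // ∀ i, σ (σ i) = i}

/-- The unitary of a layer, namely the tensor product of the gates `u i` on the pairs
`(i, σ i)` with `i < σ i`, and of the identity on the idle qubits. -/
def layerUnitary {n : ℕ} (σ : Layer n) (u : Fin n → Gate) : Op n :=
  Matrix.of fun x y => ∏ i,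
    if i < σ.1 i then (u i).1 (x i, x (σ.1 i)) (y i, y (σ.1 i))
    else if σ.1 i = i then (if x i = y i then 1 else 0)
    else 1

/-- The noisy entangling circuit: `V₁, V₂, …, V_m` are applied in this order, each one followed
by a layer of noise. -/
def entangle {n : ℕ} (p : ℝ) (V : List (Op n)) (X : Op n) : Op n :=
  V.foldl (fun Y W => noiseLayer p (W * Y * W.conjTranspose)) X

/-- The noisy uncomputing circuit: `V_m†, …, V₂†, V₁†` are applied in this order, each one
followed by a layer of noise. -/
def uncompute {n : ℕ} (p : ℝ) (V : List (Op n)) (X : Op n) : Op n :=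
  V.foldr (fun W Y => noiseLayer p (W.conjTranspose * Y * W)) X

/-- The noisy circuit of depth `2 m` with gate pattern `S` and gates `U`.
If `pre` is true, then a layer of noise also precedes the first layer of gates. -/
def circuit {n m : ℕ} (p : ℝ) (pre : Bool) (S : Fin m → Layer n) (U : Fin m → Fin n → Gate)
    (X : Op n) : Op n :=
  let V : List (Op n) := List.ofFn fun t => layerUnitary (S t) (U t)
  uncompute p V (entangle p V (if pre then noiseLayer p X else X))

/-- The average of the circuit with gate pattern `S` over independent Haar-random gates. -/
def haarAverage {n m : ℕ} (p : ℝ) (pre : Bool) (S : Fin m → Layer n) (X : Op n) : Op n :=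
  Matrix.of fun x y => ∫ U : Fin m → Fin n → Gate, circuit p pre S U X x y
    ∂(MeasureTheory.Measure.pi fun _ => MeasureTheory.Measure.pi fun _ => haarGate)

/-- An architecture with `m` entangling layers on `n` qubits: a probability law for the
sequence of layers, which is a point mass if the arrangement of the gates is fixed. -/
abbrev Architecture (n m : ℕ) : Type := PMF (Fin m → Layer n)

/-- Relabelling of the qubits in a sequence of layers. -/
def relabel {n m : ℕ} (g : Equiv.Perm (Fin n)) (S : Fin m → Layer n) : Fin m → Layer n :=
  fun t => ⟨g * (S t).1 * g⁻¹, fun i => by simp [(S t).2]⟩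

/-- Translation invariance: any qubit can be moved to any other one by a symmetry of the
architecture. -/
def TranslationInvariant {n m : ℕ} (A : Architecture n m) : Prop :=
  ∀ i j : Fin n, ∃ g : Equiv.Perm (Fin n), g i = j ∧ A.map (relabel g) = A

/-- The averaged channel of an architecture. -/
def avgChannel {n m : ℕ} (p : ℝ) (pre : Bool) (A : Architecture n m) (X : Op n) : Op n :=
  ∑ S, ((A S).toReal : ℂ) • haarAverage p pre S X

/-! ### Depolarized qubits -/

/-- `π` is a probability distribution on error patterns, and `Φ` is the channel that erases the
qubits of an error pattern drawn from `π`. -/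
structure IsErrorLaw {n : ℕ} (Φ : Op n → Op n) (π : (Fin n → Bool) → ℝ) : Prop where
  nonneg : ∀ j, 0 ≤ π j
  sum_eq_one : ∑ j, π j = 1
  eq_mixture : ∀ X, Φ X = ∑ j, (π j : ℂ) • errorMap j X

/-- The expected number of depolarized qubits when the error pattern has law `π`. -/
def expectedErrors {n : ℕ} (π : (Fin n → Bool) → ℝ) : ℝ :=
  ∑ j, π j * (Finset.univ.filter fun i => j i = true).card

/-! ### Max-Cut -/

/-- The cost function `½ ∑_{i<j} a_ij (1 - z_i z_j)` on `{-1, 1}ⁿ`. -/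
def cost {n : ℕ} (a : Matrix (Fin n) (Fin n) ℝ) (z : Fin n → ℤˣ) : ℝ :=
  1 / 2 * ∑ i, ∑ j ∈ Finset.Ioi i, a i j * (1 - ((z i : ℤ) : ℝ) * ((z j : ℤ) : ℝ))

/-- The maximum cut. -/
def maxCut {n : ℕ} (a : Matrix (Fin n) (Fin n) ℝ) : ℝ :=
  Finset.univ.sup' Finset.univ_nonempty (cost a)

/-- Pauli `Z` on qubit `i`. -/
def pauliZ {n : ℕ} (i : Fin n) : Op n := Matrix.diagonal fun x => (-1 : ℂ) ^ (x i : ℕ)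

/-- The cost function as an operator, `½ ∑_{i<j} a_ij (1 - Z_i Z_j)`. -/
def costOp {n : ℕ} (a : Matrix (Fin n) (Fin n) ℝ) : Op n :=
  (1 / 2 : ℂ) • ∑ i, ∑ j ∈ Finset.Ioi i, (a i j : ℂ) • (1 - pauliZ i * pauliZ j)

/-- The average cost of random guessing, `tr(C) / 2ⁿ`. -/
def avgCut {n : ℕ} (a : Matrix (Fin n) (Fin n) ℝ) : ℝ := (costOp a).trace.re / 2 ^ n

end NoisyEcho

end

/-! The average of an echo circuit over its gates is computed from the innermost layer outwards.
Between the gates `V` and `V†` of the innermost layer there is only noise, which is a mixture of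
error maps `errorMap j`. On a pair of qubits, the Haar average of `V† E V` for an error map `E`
commutes with all conjugations by two-qubit unitaries, hence is a combination of the identity and
of `X ↦ tr(X) 1` (`commutant_eq`). The coefficients follow from the preservation of the trace
and from the trace of `E` as an endomorphism, which the average does not change
(`haarTwirl_eq`). So an error on both qubits or on neither of them is kept, and an error on one of
them becomes an error on neither with probability `1/5` and on both with probability `4/5`. As the
unitary of a layer, the error maps and the product of the Haar measures factorize over the pairs,
the average over a whole layer is again a mixture of error maps (`layer_twirl`). The noise of the
neighbouring layers acts on the error law as a stochastic matrix, and the next pair of layers meets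
the same situation. This gives an explicit recursion for the law (`circuitLaw`,
`haarAverage_isMixture`), which is equivariant under relabelling of the qubits.

The law is unique: `errorMap j` annihilates the product `Z_T` of Pauli operators if the errors of
`j` meet `T`, and fixes it otherwise, so the expectation values of the `Z_T` in the state `|0…0⟩` are
the sums of the law over lower sets of error patterns, which determine it (`errorLaw_unique`).

For the energy bound, let `D` be the random set of qubits without error. By translation invariance
every qubit is in `D` with the same probability `f`, which is `1 - ⟨q⟩/n`. The operator `Z_i Z_k` is
damped by the probability `s` that `D` contains both `i` and `k`. No correlation inequality for `s`
is needed: for a bit string `z`, the maximum cut is at least the cut of `z`, and also at least the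
cut of the string with the qubits of `D` flipped, averaged over `D`. The latter average involves
only `f` and the numbers `s`, and a suitable combination of the two inequalities gives the bound
edge by edge (`cut_bound`). -/

open MeasureTheory

namespace NoisyEcho

/-! ### Linear maps on matrices -/

/-- A linear map on matrices is determined entrywise by its values on the matrix units. -/
lemma linearMap_apply_eq_sum {ι κ : Type*} [Fintype ι] [DecidableEq ι]
    (L : Matrix ι ι ℂ →ₗ[ℂ] Matrix κ κ ℂ) (X : Matrix ι ι ℂ) (x y : κ) :
    L X x y = ∑ a, ∑ b, X a b * L (Matrix.single a b 1) x y := by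
  conv_lhs => rw [Matrix.matrix_eq_sum_single X]
  have h1 : ∀ a b, Matrix.single a b (X a b) = X a b • Matrix.single a b (1 : ℂ) := by
    intro a b; simp
  simp only [h1, map_sum, map_smul, Matrix.sum_apply, Matrix.smul_apply, smul_eq_mul]

/-- Linear maps on matrices that agree on the matrix units are equal. -/
lemma linearMap_ext_single {ι κ : Type*} [Fintype ι] [DecidableEq ι]
    {L L' : Matrix ι ι ℂ →ₗ[ℂ] Matrix κ κ ℂ}
    (h : ∀ a b x y, L (Matrix.single a b 1) x y = L' (Matrix.single a b 1) x y)
    (X : Matrix ι ι ℂ) : L X = L' X := by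
  ext x y
  simp only [linearMap_apply_eq_sum L X, linearMap_apply_eq_sum L' X, h]

lemma mul_single_mul_apply {ι : Type*} [Fintype ι] [DecidableEq ι] (W V : Matrix ι ι ℂ)
    (a b x y : ι) : (W * Matrix.single a b (1 : ℂ) * V : Matrix ι ι ℂ) x y = W x a * V b y := by
  rw [Matrix.mul_apply, Finset.sum_eq_single b]
  · rw [Matrix.mul_apply, Finset.sum_eq_single a]
    · simp
    · intro c _ h; simp [h.symm]
    · simp
  · intro c _ h
    rw [Matrix.mul_apply, Finset.sum_eq_zero, zero_mul]
    intro d _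
    simp [h.symm]
  · simp

/-- Entries of `W† T(W |x'⟩⟨y'| W†) W`. -/
lemma conj_twirl_entry {ι : Type*} [Fintype ι] [DecidableEq ι] (W : Matrix ι ι ℂ)
    (T : Matrix ι ι ℂ →ₗ[ℂ] Matrix ι ι ℂ) (x' y' x y : ι) :
    (W.conjTranspose * T (W * Matrix.single x' y' (1 : ℂ) * W.conjTranspose) * W :
      Matrix ι ι ℂ) x y =
      ∑ a, ∑ b, ∑ a', ∑ b', star (W a x) * W b y * (W a' x' * star (W b' y')) *
        T (Matrix.single a' b' 1) a b := by
  generalize hY : (W * Matrix.single x' y' (1 : ℂ) * W.conjTranspose : Matrix ι ι ℂ) = Y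
  have hY' : ∀ a' b', Y a' b' = W a' x' * star (W b' y') := by
    intro a' b'
    rw [← hY, mul_single_mul_apply, Matrix.conjTranspose_apply]
  generalize hZ : T Y = Z
  have hZ' : ∀ a b, Z a b = ∑ a', ∑ b', Y a' b' * T (Matrix.single a' b' 1) a b := by
    intro a b
    rw [← hZ, linearMap_apply_eq_sum T Y a b]
  have h1 : (W.conjTranspose * Z * W : Matrix ι ι ℂ) x y =
      ∑ a, ∑ b, star (W a x) * W b y * Z a b := by
    rw [Matrix.mul_apply, Finset.sum_comm]
    refine Finset.sum_congr rfl fun b _ => ?_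
    rw [Matrix.mul_apply, Finset.sum_mul]
    refine Finset.sum_congr rfl fun a _ => ?_
    rw [Matrix.conjTranspose_apply]
    ring
  rw [h1]
  simp only [hZ', hY', Finset.mul_sum, mul_assoc]

/-! ### Maps on two qubits that commute with all unitary conjugations -/

/-- Operators on two qubits. -/
abbrev PairOp : Type := Matrix (Fin 2 × Fin 2) (Fin 2 × Fin 2) ℂ

/-- Conjugation `X ↦ U X U†` by a two-qubit gate. -/
def gateConj (U : Gate) : PairOp →ₗ[ℂ] PairOp :=
  LinearMap.mulLeft ℂ U.1 ∘ₗ LinearMap.mulRight ℂ (star U.1)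

lemma gateConj_apply (U : Gate) (X : PairOp) : gateConj U X = U.1 * (X * star U.1) := rfl

lemma gateConj_mul (U V : Gate) (X : PairOp) :
    gateConj (U * V) X = gateConj U (gateConj V X) := by
  simp [gateConj_apply, mul_assoc]

lemma gateConj_one (X : PairOp) : gateConj 1 X = X := by
  simp [gateConj_apply]

lemma gateConj_comp_inv (U : Gate) : gateConj U * gateConj U⁻¹ = 1 := by
  ext1 X
  rw [Module.End.mul_apply, ← gateConj_mul, mul_inv_cancel, gateConj_one]
  rfl

/-- The gate that multiplies the basis vector `k` by `i` and fixes the other basis vectors. -/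
def phaseGate (k : Fin 2 × Fin 2) : Gate :=
  ⟨Matrix.diagonal fun a => if a = k then Complex.I else 1, by
    rw [Matrix.mem_unitaryGroup_iff, Matrix.star_eq_conjTranspose, Matrix.diagonal_conjTranspose,
      Matrix.diagonal_mul_diagonal, ← Matrix.diagonal_one]
    congr 1
    ext a
    by_cases h : a = k <;> simp [h]⟩

lemma gateConj_phaseGate (k : Fin 2 × Fin 2) (X : PairOp) (a b : Fin 2 × Fin 2) :
    gateConj (phaseGate k) X a b =
      (if a = k then Complex.I else 1) * X a b * (if b = k then -Complex.I else 1) := by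
  simp only [gateConj_apply, phaseGate, Matrix.star_eq_conjTranspose,
    Matrix.diagonal_conjTranspose, Matrix.diagonal_mul, Matrix.mul_diagonal, Pi.star_apply]
  by_cases h : b = k <;> simp [h, mul_assoc]

/-- The gate that permutes the basis vectors. -/
def permGate (π : Equiv.Perm (Fin 2 × Fin 2)) : Gate :=
  ⟨(1 : PairOp).submatrix π id, by
    rw [Matrix.mem_unitaryGroup_iff, Matrix.star_eq_conjTranspose, Matrix.conjTranspose_submatrix,
      Matrix.conjTranspose_one]
    ext a b
    simp [Matrix.mul_apply, Matrix.one_apply]⟩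

lemma gateConj_permGate (π : Equiv.Perm (Fin 2 × Fin 2)) (X : PairOp) (a b : Fin 2 × Fin 2) :
    gateConj (permGate π) X a b = X (π a) (π b) := by
  simp [gateConj_apply, permGate, Matrix.star_eq_conjTranspose, Matrix.mul_apply, Matrix.one_apply]

/-- A real rotation of the first qubit, with the rational entries `3/5` and `4/5`. -/
noncomputable def rotationGate : Gate :=
  ⟨Matrix.of fun a b =>
    if a.2 = b.2 then ((!![(3 / 5 : ℝ), -4 / 5; 4 / 5, 3 / 5] a.1 b.1 : ℝ) : ℂ) else 0, by
    rw [Matrix.mem_unitaryGroup_iff, Matrix.star_eq_conjTranspose]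
    ext ⟨a, a'⟩ ⟨b, b'⟩
    fin_cases a <;> fin_cases a' <;> fin_cases b <;> fin_cases b' <;>
      simp [Matrix.mul_apply, Fintype.sum_prod_type, Complex.ext_iff] <;> norm_num⟩

section Commutant

/-- A linear map on two-qubit operators that commutes with all unitary conjugations. -/
def IsCovariant (T : PairOp →ₗ[ℂ] PairOp) : Prop :=
  ∀ G X, T (gateConj G X) = gateConj G (T X)

variable {T : PairOp →ₗ[ℂ] PairOp}

/-- The matrix units are eigenvectors of the conjugations by phase gates, so a nonzero entry
`(c, d)` of the image of the matrix unit `(a, b)` forces the eigenvalues of `(a, b)` and `(c, d)` to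
agree. -/
lemma commutant_phase (hT : IsCovariant T) (a b c d k : Fin 2 × Fin 2) :
    (if a = k then Complex.I else 1) * (if b = k then -Complex.I else 1)
        * T (Matrix.single a b 1) c d =
      (if c = k then Complex.I else 1) * (if d = k then -Complex.I else 1)
        * T (Matrix.single a b 1) c d := by
  have h1 : gateConj (phaseGate k) (Matrix.single a b 1) =
      ((if a = k then Complex.I else 1) * (if b = k then -Complex.I else 1) : ℂ)
        • Matrix.single a b 1 := by
    ext x y
    rw [gateConj_phaseGate, Matrix.smul_apply, Matrix.single_apply]
    split_ifs <;> simp_all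
  have h2 := congrFun₂ (hT (phaseGate k) (Matrix.single a b 1)) c d
  rw [h1, map_smul, gateConj_phaseGate, Matrix.smul_apply, smul_eq_mul] at h2
  rw [h2]
  ring

lemma commutant_offDiag (hT : IsCovariant T) {a b c d : Fin 2 × Fin 2} (hab : a ≠ b)
    (h : ¬ (a = c ∧ b = d)) :
    T (Matrix.single a b 1) c d = 0 := by
  by_contra h0
  by_cases hc : c = a
  · have hd : d ≠ b := fun hd => h ⟨hc.symm, hd.symm⟩
    have := mul_right_cancel₀ h0 (commutant_phase hT a b c d b)
    by_cases hcb : c = b <;> simp [hab, hd, hcb, Complex.ext_iff] at this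
    norm_num at this
  · have := mul_right_cancel₀ h0 (commutant_phase hT a b c d a)
    by_cases hda : d = a <;> simp [hab.symm, hc, hda, Complex.ext_iff] at this
    norm_num at this

lemma commutant_diag (hT : IsCovariant T) {a c d : Fin 2 × Fin 2} (hcd : c ≠ d) :
    T (Matrix.single a a 1) c d = 0 := by
  by_contra h0
  have := mul_right_cancel₀ h0 (commutant_phase hT a a c d c)
  by_cases hac : a = c <;> simp [hac, hcd.symm, Complex.ext_iff] at this

lemma commutant_perm (hT : IsCovariant T) (π : Equiv.Perm (Fin 2 × Fin 2))
    (a b c d : Fin 2 × Fin 2) :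
    T (Matrix.single (π a) (π b) 1) (π c) (π d) = T (Matrix.single a b 1) c d := by
  have h1 : gateConj (permGate π) (Matrix.single (π a) (π b) 1) = Matrix.single a b 1 := by
    ext x y
    rw [gateConj_permGate, Matrix.single_apply, Matrix.single_apply]
    simp
  rw [← gateConj_permGate π (T _), ← hT, h1]

lemma exists_perm_pair {a c a' c' : Fin 2 × Fin 2} (h : a ≠ c) (h' : a' ≠ c') :
    ∃ π : Equiv.Perm (Fin 2 × Fin 2), π a = a' ∧ π c = c' := by
  refine ⟨Equiv.swap (Equiv.swap a a' c) c' * Equiv.swap a a', ?_, ?_⟩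
  · rw [Equiv.Perm.mul_apply, Equiv.swap_apply_left, Equiv.swap_apply_of_ne_of_ne _ h']
    intro h2
    apply h
    apply (Equiv.swap a a').injective
    rw [Equiv.swap_apply_left, ← h2]
  · simp

/-- Invariance under a single rotation links the diagonal and the off-diagonal coefficients. -/
lemma commutant_rotation (hT : IsCovariant T) :
    T (Matrix.single (0, 0) (1, 0) 1) (0, 0) (1, 0) =
      T (Matrix.single (0, 0) (0, 0) 1) (0, 0) (0, 0)
        - T (Matrix.single (0, 0) (0, 0) 1) (1, 0) (1, 0) := by
  have h1 : gateConj rotationGate (Matrix.single (0, 0) (0, 0) 1) =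
      (9 / 25 : ℂ) • Matrix.single (0, 0) (0, 0) 1 + (12 / 25 : ℂ) • Matrix.single (0, 0) (1, 0) 1
      + (12 / 25 : ℂ) • Matrix.single (1, 0) (0, 0) 1
      + (16 / 25 : ℂ) • Matrix.single (1, 0) (1, 0) 1 := by
    ext ⟨a, a'⟩ ⟨b, b'⟩
    fin_cases a <;> fin_cases a' <;> fin_cases b <;> fin_cases b' <;>
      simp [gateConj_apply, rotationGate, Matrix.mul_apply, Fintype.sum_prod_type,
        Matrix.single_apply, Complex.ext_iff] <;> norm_num
  have h2 := congrFun₂ (hT rotationGate (Matrix.single (0, 0) (0, 0) 1)) (0, 0) (1, 0)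
  have e1 : T (Matrix.single (1, 0) (0, 0) 1) (0, 0) (1, 0) = 0 :=
    commutant_offDiag hT (by decide) (by decide)
  have e2 : T (Matrix.single (0, 0) (0, 0) 1) (0, 0) (1, 0) = 0 := commutant_diag hT (by decide)
  have e3 : T (Matrix.single (1, 0) (1, 0) 1) (0, 0) (1, 0) = 0 := commutant_diag hT (by decide)
  have e4 : T (Matrix.single (0, 0) (0, 0) 1) (1, 0) (0, 0) = 0 := commutant_diag hT (by decide)
  rw [h1] at h2
  simp only [map_add, map_smul, Matrix.add_apply, Matrix.smul_apply, e1, e2, e3, gateConj_apply,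
    rotationGate, Matrix.mul_apply, Fintype.sum_prod_type, Fin.sum_univ_two,
    Matrix.star_eq_conjTranspose, Matrix.conjTranspose_apply, Matrix.of_apply] at h2
  simp [e4] at h2
  linear_combination (25 / 12 : ℂ) * h2

/-- A linear map on two-qubit operators that commutes with all unitary conjugations is a
combination of the identity and of `X ↦ tr(X) 1`. -/
lemma commutant_eq (hT : IsCovariant T) :
    ∃ γ β : ℂ, ∀ X, T X = γ • X + (β * X.trace) • (1 : PairOp) := by
  set β := T (Matrix.single (0, 0) (0, 0) 1) (1, 0) (1, 0) with hβ
  set γ := T (Matrix.single (0, 0) (1, 0) 1) (0, 0) (1, 0) with hγ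
  have hne : ((0, 0) : Fin 2 × Fin 2) ≠ (1, 0) := by decide
  have key1 : ∀ a c : Fin 2 × Fin 2, a ≠ c → T (Matrix.single a a 1) c c = β := by
    intro a c hac
    obtain ⟨π, h1, h2⟩ := exists_perm_pair hne hac
    rw [← h1, ← h2, commutant_perm hT]
  have key2 : ∀ a c : Fin 2 × Fin 2, a ≠ c → T (Matrix.single a c 1) a c = γ := by
    intro a c hac
    obtain ⟨π, h1, h2⟩ := exists_perm_pair hne hac
    rw [← h1, ← h2, commutant_perm hT]
  have key3 : ∀ a : Fin 2 × Fin 2, T (Matrix.single a a 1) a a = γ + β := by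
    intro a
    rw [hγ, commutant_rotation hT, ← hβ, sub_add_cancel]
    have h := commutant_perm hT (Equiv.swap (0, 0) a) (0, 0) (0, 0) (0, 0) (0, 0)
    rwa [Equiv.swap_apply_left] at h
  have key : ∀ a b c d : Fin 2 × Fin 2, T (Matrix.single a b 1) c d =
      (if a = c ∧ b = d then γ else 0) + (if a = b ∧ c = d then β else 0) := by
    intro a b c d
    by_cases hab : a = b
    · subst hab
      by_cases hcd : c = d
      · subst hcd
        by_cases hac : a = c
        · subst hac; simp [key3]
        · simp [hac, key1 a c hac]
      · rw [commutant_diag hT hcd]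
        have : ¬ (a = c ∧ a = d) := fun h => hcd (h.1.symm.trans h.2)
        simp [hcd, this]
    · by_cases h : a = c ∧ b = d
      · obtain ⟨rfl, rfl⟩ := h
        simp [hab, key2 a b hab]
      · rw [commutant_offDiag hT hab h]
        simp [hab, h]
  refine ⟨γ, β, fun X => ?_⟩
  ext c d
  rw [linearMap_apply_eq_sum]
  simp only [Matrix.smul_apply, key, smul_eq_mul, mul_add,
    Finset.sum_add_distrib, Matrix.add_apply, ite_and, mul_ite, mul_zero, Finset.sum_ite_eq,
    Finset.sum_ite_irrel, Finset.sum_const_zero, Finset.mem_univ, if_true, Matrix.one_apply,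
    Matrix.trace, Matrix.diag]
  by_cases hcd : c = d <;> simp [hcd, mul_comm, Finset.sum_mul]

end Commutant

/-- The trace of a linear map on two-qubit operators as an endomorphism, in the basis of matrix
units. -/
lemma pair_trace_eq_sum (F : PairOp →ₗ[ℂ] PairOp) :
    LinearMap.trace ℂ PairOp F = ∑ a, ∑ b, F (Matrix.single a b 1) a b := by
  rw [LinearMap.trace_eq_matrix_trace ℂ (Matrix.stdBasis ℂ (Fin 2 × Fin 2) (Fin 2 × Fin 2)),
    Matrix.trace, Fintype.sum_prod_type]
  refine Finset.sum_congr rfl fun a _ => Finset.sum_congr rfl fun b _ => ?_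
  rw [Matrix.diag_apply, LinearMap.toMatrix_apply, Matrix.stdBasis_eq_single]
  simp [Matrix.stdBasis]

/-! ### Haar averages over two-qubit gates -/

instance : IsProbabilityMeasure haarGate := by
  constructor
  simpa [haarGate] using Measure.haarMeasure_self
    (K₀ := (⊤ : TopologicalSpace.PositiveCompacts Gate))

instance : haarGate.IsHaarMeasure := by
  unfold haarGate
  infer_instance

/-- The Haar measure of the compact group `U(4)` is also right-invariant: its right translates are
Haar probability measures, hence equal to it. -/
instance : haarGate.IsMulRightInvariant where
  map_mul_right_eq_self g := by
    have : IsProbabilityMeasure (haarGate.map (· * g)) :=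
      Measure.isProbabilityMeasure_map (by fun_prop)
    have : (haarGate.map (· * g)).IsHaarMeasure :=
      { lt_top_of_isCompact := fun _ _ => measure_lt_top _ _
        map_mul_left_eq_self :=
          (isMulLeftInvariant_map_mul_right (μ := haarGate) g).map_mul_left_eq_self
        open_pos := by
          intro U hU hne
          rw [Measure.map_apply (by fun_prop) hU.measurableSet]
          refine (hU.preimage (by fun_prop)).measure_ne_zero haarGate ?_
          obtain ⟨u, hu⟩ := hne
          exact ⟨u * g⁻¹, by simpa using hu⟩ }
    exact Measure.isHaarMeasure_eq_of_isProbabilityMeasure _ _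

instance : SecondCountableTopology Gate := by
  have : SecondCountableTopology (Matrix (Fin 2 × Fin 2) (Fin 2 × Fin 2) ℂ) :=
    inferInstanceAs (SecondCountableTopology (Fin 2 × Fin 2 → Fin 2 × Fin 2 → ℂ))
  exact TopologicalSpace.Subtype.secondCountableTopology _

lemma integrable_of_continuous_compact {Ω : Type*} [TopologicalSpace Ω] [CompactSpace Ω]
    [MeasurableSpace Ω] [OpensMeasurableSpace Ω] {μ : Measure Ω} [IsFiniteMeasure μ] {f : Ω → ℂ}
    (hf : Continuous f) : Integrable f μ :=
  hf.integrable_of_hasCompactSupport (HasCompactSupport.of_compactSpace f)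

/-- Linear maps on matrices commute with the entrywise integral. -/
lemma linearMap_integral_entries {Ω ι κ : Type*} [MeasurableSpace Ω] {μ : Measure Ω} [Fintype ι]
    [DecidableEq ι] (L : Matrix ι ι ℂ →ₗ[ℂ] Matrix κ κ ℂ) (F : Ω → Matrix ι ι ℂ)
    (hF : ∀ a b, Integrable (fun ω => F ω a b) μ) (x y : κ) :
    L (Matrix.of fun a b => ∫ ω, F ω a b ∂μ) x y = ∫ ω, L (F ω) x y ∂μ := by
  rw [linearMap_apply_eq_sum, integral_congr_ae
    (Filter.Eventually.of_forall fun ω => linearMap_apply_eq_sum L (F ω) x y)]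
  simp only [Matrix.of_apply]
  rw [integral_finsetSum _ fun a _ =>
    integrable_finsetSum _ fun b _ => (hF a b).mul_const _]
  refine Finset.sum_congr rfl fun a _ => ?_
  rw [integral_finsetSum _ fun b _ => (hF a b).mul_const _]
  exact Finset.sum_congr rfl fun b _ => (integral_mul_const _ _).symm

lemma continuous_matrix_linearMap {Ω ι κ : Type*} [TopologicalSpace Ω] [Finite ι] [Finite κ]
    (L : Matrix ι ι ℂ →ₗ[ℂ] Matrix κ κ ℂ) {F : Ω → Matrix ι ι ℂ} (hF : Continuous F) :
    Continuous fun ω => L (F ω) := by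
  have : Continuous L := L.continuous_of_finiteDimensional
  exact this.comp hF

lemma continuous_gateConj {Ω : Type*} [TopologicalSpace Ω] {U : Ω → Gate} {F : Ω → PairOp}
    (hU : Continuous U) (hF : Continuous F) : Continuous fun ω => gateConj (U ω) (F ω) := by
  simp only [gateConj_apply]
  have h : Continuous fun ω => (U ω).1 := continuous_subtype_val.comp hU
  exact h.matrix_mul (hF.matrix_mul h.star)

lemma continuous_twirl_entry (F : PairOp →ₗ[ℂ] PairOp) (X : PairOp) (a b : Fin 2 × Fin 2) :
    Continuous fun U : Gate => gateConj U⁻¹ (F (gateConj U X)) a b := by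
  have h : Continuous fun U : Gate => gateConj U⁻¹ (F (gateConj U X)) :=
    continuous_gateConj continuous_inv
      (continuous_matrix_linearMap F (continuous_gateConj continuous_id continuous_const))
  exact h.matrix_elem a b

/-- The Haar twirl `X ↦ ∫ U† F(U X U†) U dU` of a linear map `F` on two-qubit operators. -/
noncomputable def haarTwirl (F : PairOp →ₗ[ℂ] PairOp) : PairOp →ₗ[ℂ] PairOp where
  toFun X := Matrix.of fun a b => ∫ U, gateConj U⁻¹ (F (gateConj U X)) a b ∂haarGate
  map_add' X Y := by
    ext a b
    simp only [map_add, Matrix.add_apply, Matrix.of_apply]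
    exact integral_add (integrable_of_continuous_compact (continuous_twirl_entry F X a b))
      (integrable_of_continuous_compact (continuous_twirl_entry F Y a b))
  map_smul' c X := by
    ext a b
    simp only [map_smul, Matrix.smul_apply, Matrix.of_apply, RingHom.id_apply, smul_eq_mul]
    exact integral_const_mul _ _

lemma haarTwirl_apply (F : PairOp →ₗ[ℂ] PairOp) (X : PairOp) (a b : Fin 2 × Fin 2) :
    haarTwirl F X a b = ∫ U, gateConj U⁻¹ (F (gateConj U X)) a b ∂haarGate := rfl

lemma haarTwirl_isCovariant (F : PairOp →ₗ[ℂ] PairOp) : IsCovariant (haarTwirl F) := by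
  intro G X
  ext a b
  have h := linearMap_integral_entries (μ := haarGate) (gateConj G)
    (fun U => gateConj U⁻¹ (F (gateConj U X)))
    (fun a b => integrable_of_continuous_compact (continuous_twirl_entry F X a b)) a b
  refine Eq.trans ?_ h.symm
  rw [haarTwirl_apply,
    ← integral_mul_right_eq_self (fun U => gateConj G (gateConj U⁻¹ (F (gateConj U X))) a b) G]
  refine integral_congr_ae (Filter.Eventually.of_forall fun U => ?_)
  simp only [← gateConj_mul, mul_inv_rev, mul_inv_cancel_left]

/-- The twirl of a trace-preserving map is a two-qubit depolarizing channel, whose parameter is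
read off from the trace of the map as an endomorphism, since the twirl does not change it. -/
lemma haarTwirl_eq (F : PairOp →ₗ[ℂ] PairOp) (hF : ∀ X, (F X).trace = X.trace) (X : PairOp) :
    haarTwirl F X = ((LinearMap.trace ℂ PairOp F - 1) / 15) • X
      + ((1 - (LinearMap.trace ℂ PairOp F - 1) / 15) / 4 * X.trace) • (1 : PairOp) := by
  obtain ⟨γ, β, h⟩ := commutant_eq (haarTwirl_isCovariant F)
  have hone : (1 : PairOp).trace = 4 := by simp [Matrix.trace_one]
  have h1 : γ + 4 * β = 1 := by
    have e1 : (haarTwirl F (Matrix.single (0, 0) (0, 0) 1)).trace = 1 := by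
      simp only [Matrix.trace, Matrix.diag_apply, haarTwirl_apply]
      rw [← integral_finsetSum _ fun a _ =>
        integrable_of_continuous_compact (continuous_twirl_entry F _ a a)]
      have e2 : ∀ (U : Gate) (Y : PairOp), (gateConj U Y).trace = Y.trace := by
        intro U Y
        rw [gateConj_apply, Matrix.trace_mul_comm, mul_assoc, Unitary.coe_star_mul_self U, mul_one]
      have e3 : ∀ U : Gate, ∑ a, gateConj U⁻¹ (F (gateConj U (Matrix.single (0, 0) (0, 0) 1))) a a
          = 1 := by
        intro U
        exact (e2 U⁻¹ _).trans (by rw [hF, e2, Matrix.trace_single_eq_same])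
      simp [e3]
    rw [h, Matrix.trace_add, Matrix.trace_smul, Matrix.trace_smul, hone,
      Matrix.trace_single_eq_same] at e1
    simpa [mul_comm] using e1
  have h2 : 16 * γ + 4 * β = LinearMap.trace ℂ PairOp F := by
    have e1 : ∀ U : Gate, ∑ a, ∑ b, gateConj U⁻¹ (F (gateConj U (Matrix.single a b 1))) a b
        = LinearMap.trace ℂ PairOp F := by
      intro U
      have := LinearMap.trace_mul_comm ℂ (gateConj U⁻¹) (F * gateConj U)
      rw [mul_assoc, gateConj_comp_inv, mul_one] at this
      rw [← this, pair_trace_eq_sum]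
      rfl
    have e2 : ∑ a, ∑ b, haarTwirl F (Matrix.single a b 1) a b = LinearMap.trace ℂ PairOp F := by
      have hi := fun a b => integrable_of_continuous_compact (μ := haarGate)
        (continuous_twirl_entry F (Matrix.single a b 1) a b)
      simp only [haarTwirl_apply]
      simp only [← integral_finsetSum _ fun b _ => hi _ b]
      rw [← integral_finsetSum _ fun a _ => integrable_finsetSum _ fun b _ => hi a b]
      simp [e1]
    rw [← e2]
    simp only [h, Matrix.add_apply, Matrix.smul_apply, Matrix.single_apply_same, smul_eq_mul,
      Finset.sum_add_distrib, mul_one]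
    simp only [Matrix.one_apply, mul_ite, mul_one, mul_zero, Finset.sum_ite_eq,
      Finset.mem_univ, if_true, Matrix.trace_single_eq_same, Finset.sum_const, Finset.card_univ,
      Fintype.card_prod, Fintype.card_fin, nsmul_eq_mul]
    push_cast
    ring
  have hγ : (LinearMap.trace ℂ PairOp F - 1) / 15 = γ := by
    rw [← h2]; linear_combination h1 / 15
  have hβ : (1 - γ) / 4 = β := by linear_combination -h1 / 4
  rw [hγ, hβ, h]

/-! ### Tensor products of one-qubit maps -/

/-- The identity (`false`) or the erasure (`true`) of one qubit. -/
noncomputable def errorKind (b : Bool) : QubitMap := if b then erase else LinearMap.id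

lemma errorMap_eq {n : ℕ} (j : Fin n → Bool) : errorMap j = tensorMap fun i => errorKind (j i) :=
  rfl

lemma erase_single (a b c d : Fin 2) :
    erase (Matrix.single a b 1) c d = if a = b ∧ c = d then 1 / 2 else 0 := by
  by_cases hab : a = b
  · subst hab
    by_cases hcd : c = d <;>
      simp [erase, hcd]
  · simp [erase, hab, Matrix.trace_single_eq_of_ne a b (1 : ℂ) hab]

lemma errorKind_single (e : Bool) (a b c d : Fin 2) :
    errorKind e (Matrix.single a b 1) c d =
      if e then (if a = b ∧ c = d then 1 / 2 else 0) else (if a = c ∧ b = d then 1 else 0) := by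
  cases e
  · simp [errorKind, Matrix.single_apply]
  · simp [errorKind, erase_single]

lemma tensorMap_apply {n : ℕ} (K : Fin n → QubitMap) (X : Op n) (x y : Fin n → Fin 2) :
    tensorMap K X x y =
      ∑ x', ∑ y', X x' y' * ∏ i, K i (Matrix.single (x' i) (y' i) 1) (x i) (y i) := rfl

/-- `tensorMap` as a linear map. -/
def tensorLin {n : ℕ} (K : Fin n → QubitMap) : Op n →ₗ[ℂ] Op n where
  toFun := tensorMap K
  map_add' X Y := by
    ext x y
    simp [tensorMap_apply, add_mul, Finset.sum_add_distrib]
  map_smul' c X := by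
    ext x y
    simp [tensorMap_apply, Finset.mul_sum, mul_assoc]

lemma tensorLin_apply {n : ℕ} (K : Fin n → QubitMap) (X : Op n) :
    tensorLin K X = tensorMap K X := rfl

lemma tensorMap_single {n : ℕ} (K : Fin n → QubitMap) (a b x y : Fin n → Fin 2) :
    tensorMap K (Matrix.single a b 1) x y =
      ∏ i, K i (Matrix.single (a i) (b i) 1) (x i) (y i) := by
  rw [tensorMap_apply, Finset.sum_eq_single a, Finset.sum_eq_single b]
  · simp
  · intro b' _ h; simp [h.symm]
  · simp
  · intro a' _ h; simp [h.symm]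
  · simp

lemma tensorMap_comp {n : ℕ} (K L : Fin n → QubitMap) (X : Op n) :
    tensorMap K (tensorMap L X) = tensorMap (fun i => K i ∘ₗ L i) X := by
  refine linearMap_ext_single (L := tensorLin K ∘ₗ tensorLin L)
    (L' := tensorLin fun i => K i ∘ₗ L i) (fun a b x y => ?_) X
  rw [LinearMap.comp_apply, tensorLin_apply, tensorLin_apply, tensorLin_apply, tensorMap_single,
    tensorMap_apply]
  simp only [tensorMap_single, LinearMap.comp_apply]
  simp only [linearMap_apply_eq_sum (K _) (L _ _), Fintype.prod_sum, Finset.prod_mul_distrib]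

lemma tensorMap_sum {n : ℕ} (K : Fin n → QubitMap) (c : Fin n → Bool → ℂ)
    (M : Bool → QubitMap) (hK : ∀ i, K i = ∑ b, c i b • M b) (X : Op n) :
    tensorMap K X = ∑ l : Fin n → Bool, (∏ i, c i (l i)) • tensorMap (fun i => M (l i)) X := by
  have := linearMap_ext_single (L := tensorLin K)
    (L' := ∑ l : Fin n → Bool, (∏ i, c i (l i)) • tensorLin (fun i => M (l i)))
    (fun a b x y => ?_) X
  · simpa [tensorLin_apply, LinearMap.sum_apply] using this
  · simp only [LinearMap.sum_apply, LinearMap.smul_apply, tensorLin_apply, Matrix.sum_apply,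
      Matrix.smul_apply, tensorMap_single, smul_eq_mul, hK, ← Finset.prod_mul_distrib]
    exact Fintype.prod_sum fun i l =>
      c i l * M l (Matrix.single (a i) (b i) 1) (x i) (y i)

/-! ### Noise acting on error laws -/

/-- The probability that noise of strength `p` turns the error bit `b` of a qubit into `c`. -/
def noiseWeight (p : ℝ) (b c : Bool) : ℝ :=
  if b then (if c then 1 else 0) else (if c then p else 1 - p)

lemma depolarizing_comp_errorKind (p : ℝ) (b : Bool) :
    depolarizing p ∘ₗ errorKind b = ∑ c, (noiseWeight p b c : ℂ) • errorKind c := by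
  have he : erase ∘ₗ erase = erase := by
    refine LinearMap.ext fun X => ?_
    simp [erase, Matrix.trace_smul, Matrix.trace_one]
  cases b
  · simp [depolarizing, errorKind, noiseWeight, add_comm]
  · simp only [depolarizing, errorKind, noiseWeight, if_true, LinearMap.add_comp,
      LinearMap.smul_comp, he, LinearMap.id_comp, Fintype.sum_bool]
    simp [← add_smul]

lemma errorKind_comp_depolarizing (p : ℝ) (b : Bool) :
    errorKind b ∘ₗ depolarizing p = ∑ c, (noiseWeight p b c : ℂ) • errorKind c := by
  rw [← depolarizing_comp_errorKind]
  cases b <;>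
    simp [depolarizing, errorKind, LinearMap.comp_add, LinearMap.add_comp, LinearMap.comp_smul,
      LinearMap.smul_comp]

/-- The law of the error pattern after a layer of noise. -/
def noiseStep {n : ℕ} (p : ℝ) (π : (Fin n → Bool) → ℝ) (l : Fin n → Bool) : ℝ :=
  ∑ k, π k * ∏ i, noiseWeight p (k i) (l i)

/-- The operation `Φ` is the combination of the maps `errorMap j` with the coefficients `π j`. -/
def IsMixture {n : ℕ} (Φ : Op n → Op n) (π : (Fin n → Bool) → ℝ) : Prop :=
  ∀ X, Φ X = ∑ j, (π j : ℂ) • errorMap j X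

lemma noiseLayer_errorMap {n : ℕ} (p : ℝ) (k : Fin n → Bool) (X : Op n) :
    noiseLayer p (errorMap k X) =
      ∑ l, ((∏ i, noiseWeight p (k i) (l i) : ℝ) : ℂ) • errorMap l X := by
  rw [noiseLayer, errorMap_eq, tensorMap_comp,
    tensorMap_sum _ (fun i c => (noiseWeight p (k i) c : ℂ)) errorKind
      (fun i => depolarizing_comp_errorKind p (k i))]
  simp only [Complex.ofReal_prod]
  rfl

lemma errorMap_noiseLayer {n : ℕ} (p : ℝ) (k : Fin n → Bool) (X : Op n) :
    errorMap k (noiseLayer p X) =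
      ∑ l, ((∏ i, noiseWeight p (k i) (l i) : ℝ) : ℂ) • errorMap l X := by
  rw [noiseLayer, errorMap_eq, tensorMap_comp,
    tensorMap_sum _ (fun i c => (noiseWeight p (k i) c : ℂ)) errorKind
      (fun i => errorKind_comp_depolarizing p (k i))]
  simp only [Complex.ofReal_prod]
  rfl

lemma sum_noiseStep_smul {n : ℕ} (p : ℝ) (π : (Fin n → Bool) → ℝ) (X : Op n) :
    ∑ k, (π k : ℂ) • ∑ l, ((∏ i, noiseWeight p (k i) (l i) : ℝ) : ℂ) • errorMap l X =
      ∑ l, (noiseStep p π l : ℂ) • errorMap l X := by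
  simp only [Finset.smul_sum, smul_smul, noiseStep, Complex.ofReal_sum, Complex.ofReal_mul,
    Finset.sum_smul]
  exact Finset.sum_comm

lemma IsMixture.noise_comp {n : ℕ} {Φ : Op n → Op n} {π : (Fin n → Bool) → ℝ}
    (h : IsMixture Φ π) (p : ℝ) : IsMixture (fun X => noiseLayer p (Φ X)) (noiseStep p π) := by
  intro X
  have := map_sum (tensorLin fun _ : Fin n => depolarizing p)
    (fun j => (π j : ℂ) • errorMap j X) Finset.univ
  rw [← sum_noiseStep_smul]
  simp only [map_smul, tensorLin_apply] at this
  change noiseLayer p (Φ X) = _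
  rw [h X]
  refine this.trans (Finset.sum_congr rfl fun j _ => ?_)
  rw [← noiseLayer_errorMap]
  rfl

lemma IsMixture.comp_noise {n : ℕ} {Φ : Op n → Op n} {π : (Fin n → Bool) → ℝ}
    (h : IsMixture Φ π) (p : ℝ) : IsMixture (fun X => Φ (noiseLayer p X)) (noiseStep p π) := by
  intro X
  rw [← sum_noiseStep_smul]
  simp only [h (noiseLayer p X), errorMap_noiseLayer]

/-! ### Products over the pairs of a layer -/

/-- The product of `f i` over the pairs `(i, σ i)` with `i < σ i`, times the product of `g i` over
the idle qubits `i`. -/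
def pairProd {R : Type*} [CommMonoid R] {n : ℕ} (σ : Layer n) (f g : Fin n → R) : R :=
  ∏ i, if i < σ.1 i then f i else if σ.1 i = i then g i else 1

lemma pairProd_congr {R : Type*} [CommMonoid R] {n : ℕ} (σ : Layer n) {f f' g g' : Fin n → R}
    (hf : ∀ i, i < σ.1 i → f i = f' i) (hg : ∀ i, σ.1 i = i → g i = g' i) :
    pairProd σ f g = pairProd σ f' g' := by
  refine Finset.prod_congr rfl fun i _ => ?_
  split_ifs with h1 h2
  · exact hf i h1
  · exact hg i h2
  · rfl

lemma pairProd_mul {R : Type*} [CommMonoid R] {n : ℕ} (σ : Layer n) (f g f' g' : Fin n → R) :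
    pairProd σ f g * pairProd σ f' g' =
      pairProd σ (fun i => f i * f' i) (fun i => g i * g' i) := by
  rw [pairProd, pairProd, ← Finset.prod_mul_distrib]
  refine Finset.prod_congr rfl fun i _ => ?_
  split_ifs <;> simp

lemma map_pairProd {R S F : Type*} [CommMonoid R] [CommMonoid S] [FunLike F R S]
    [MonoidHomClass F R S] (φ : F) {n : ℕ} (σ : Layer n) (f g : Fin n → R) :
    φ (pairProd σ f g) = pairProd σ (fun i => φ (f i)) (fun i => φ (g i)) := by
  rw [pairProd, map_prod]
  refine Finset.prod_congr rfl fun i _ => ?_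
  split_ifs <;> simp

/-- Grouping of a product over all qubits according to the pairs of a layer. -/
lemma prod_eq_pairProd {R : Type*} [CommMonoid R] {n : ℕ} (σ : Layer n) (h : Fin n → R) :
    ∏ i, h i = pairProd σ (fun i => h i * h (σ.1 i)) h := by
  have h1 : pairProd σ (fun i => h i * h (σ.1 i)) h =
      (∏ i, if σ.1 i < i then 1 else h i) * ∏ i, if i < σ.1 i then h (σ.1 i) else 1 := by
    rw [pairProd, ← Finset.prod_mul_distrib]
    refine Finset.prod_congr rfl fun i _ => ?_
    rcases lt_trichotomy i (σ.1 i) with hi | hi | hi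
    · simp [hi, hi.not_gt]
    · simp [← hi]
    · simp [hi, hi.not_gt, hi.ne]
  have h2 : (∏ i, if i < σ.1 i then h (σ.1 i) else 1) = ∏ i, if σ.1 i < i then h i else 1 := by
    rw [← Equiv.prod_comp σ.1 fun i => if σ.1 i < i then h i else 1]
    simp only [σ.2]
  rw [h1, h2, ← Finset.prod_mul_distrib]
  refine Finset.prod_congr rfl fun i _ => ?_
  split_ifs <;> simp

/-- A sum over all assignments of values to the qubits of a product over the pairs and the idle
qubits of a layer factorizes. -/
lemma sum_pairProd {R : Type*} [CommSemiring R] {T : Type*} [Fintype T] [DecidableEq T]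
    [Inhabited T] {n : ℕ} (σ : Layer n) (f : Fin n → T → T → R) (g : Fin n → T → R) :
    ∑ c : Fin n → T, pairProd σ (fun i => f i (c i) (c (σ.1 i))) (fun i => g i (c i)) =
      pairProd σ (fun i => ∑ s, ∑ t, f i s t) (fun i => ∑ s, g i s) := by
  -- An assignment is encoded by the values `p i = (c i, c (σ i))` for `i ≤ σ i`, where `p i` ranges
  -- over all pairs if `i < σ i` and over the diagonal if `σ i = i`; the redundant `p i` with
  -- `σ i < i` is constant.
  let A : Fin n → Finset (T × T) := fun i =>
    if i < σ.1 i then Finset.univ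
    else if σ.1 i = i then Finset.univ.image fun s => (s, s) else {default}
  let F : Fin n → T × T → R := fun i p =>
    if i < σ.1 i then f i p.1 p.2 else if σ.1 i = i then g i p.1 else 1
  have hR : pairProd σ (fun i => ∑ s, ∑ t, f i s t) (fun i => ∑ s, g i s) =
      ∏ i, ∑ p ∈ A i, F i p := by
    refine Finset.prod_congr rfl fun i _ => ?_
    by_cases h1 : i < σ.1 i
    · simp [A, F, h1, Fintype.sum_prod_type]
    · by_cases h2 : σ.1 i = i
      · simp only [A, F, h2, lt_irrefl, if_false, if_true]
        rw [Finset.sum_image (by intro a _ b _ h; exact (Prod.mk.inj h).1)]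
      · simp [A, F, h1, h2]
  rw [hR, Finset.prod_univ_sum]
  refine Finset.sum_bij'
    (fun c _ i => if i ≤ σ.1 i then (c i, c (σ.1 i)) else default)
    (fun p _ i => if i ≤ σ.1 i then (p i).1 else (p (σ.1 i)).2) ?_ ?_ ?_ ?_ ?_
  · intro c _
    rw [Fintype.mem_piFinset]
    intro i
    rcases lt_trichotomy i (σ.1 i) with hi | hi | hi
    · simp [A, hi]
    · simp [A, ← hi]
    · simp [A, hi.not_gt, hi.not_ge, hi.ne]
  · intro p _
    exact Finset.mem_univ _
  · intro c _
    funext i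
    rcases le_or_gt i (σ.1 i) with hi | hi
    · simp [hi]
    · simp [hi.not_ge, hi.le, σ.2]
  · intro p hp
    rw [Fintype.mem_piFinset] at hp
    funext i
    have hpi := hp i
    rcases lt_trichotomy i (σ.1 i) with hi | hi | hi
    · simp [hi.le, hi.not_ge, σ.2]
    · simp only [A, ← hi, lt_irrefl, if_false, if_true, Finset.mem_image] at hpi
      obtain ⟨s, _, hs⟩ := hpi
      simp [← hi, ← hs]
    · simp only [A, hi.not_gt, hi.ne, if_false, Finset.mem_singleton] at hpi
      simp [hi.not_ge, hpi]
  · intro c _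
    refine Finset.prod_congr rfl fun i _ => ?_
    rcases lt_trichotomy i (σ.1 i) with hi | hi | hi
    · simp [F, hi, hi.le]
    · simp [F, ← hi]
    · simp [F, hi.not_gt, hi.ne]

/-! ### The twirl of an error pattern by a layer of gates -/

/-- The tensor product of two one-qubit maps. -/
def pairMap (K L : QubitMap) : PairOp →ₗ[ℂ] PairOp where
  toFun Y := Matrix.of fun a b => ∑ a', ∑ b', Y a' b' *
    (K (Matrix.single a'.1 b'.1 1) a.1 b.1 * L (Matrix.single a'.2 b'.2 1) a.2 b.2)
  map_add' X Y := by
    ext x y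
    simp [add_mul, Finset.sum_add_distrib]
  map_smul' c X := by
    ext x y
    simp [Finset.mul_sum, mul_assoc]

lemma pairMap_apply (K L : QubitMap) (Y : PairOp) (a b : Fin 2 × Fin 2) :
    pairMap K L Y a b = ∑ a', ∑ b', Y a' b' *
      (K (Matrix.single a'.1 b'.1 1) a.1 b.1 * L (Matrix.single a'.2 b'.2 1) a.2 b.2) := rfl

lemma pairMap_single (K L : QubitMap) (a b c d : Fin 2 × Fin 2) :
    pairMap K L (Matrix.single a b 1) c d =
      K (Matrix.single a.1 b.1 1) c.1 d.1 * L (Matrix.single a.2 b.2 1) c.2 d.2 := by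
  rw [pairMap_apply, Finset.sum_eq_single a, Finset.sum_eq_single b]
  · simp
  · intro b' _ h; simp [h.symm]
  · simp
  · intro a' _ h; simp [h.symm]
  · simp

lemma trace_errorKind (e : Bool) (Y : Matrix (Fin 2) (Fin 2) ℂ) :
    (errorKind e Y).trace = Y.trace := by
  cases e <;> simp [errorKind, erase]

lemma trace_pairMap_errorKind (b b' : Bool) (Y : PairOp) :
    (pairMap (errorKind b) (errorKind b') Y).trace = Y.trace := by
  have h : (Matrix.traceLinearMap _ ℂ ℂ) ∘ₗ pairMap (errorKind b) (errorKind b') =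
      Matrix.traceLinearMap (Fin 2 × Fin 2) ℂ ℂ := by
    apply Matrix.ext_linearMap
    rintro ⟨x1, x2⟩ ⟨y1, y2⟩
    refine LinearMap.ext_ring ?_
    simp only [LinearMap.comp_apply, Matrix.singleLinearMap_apply, Matrix.traceLinearMap_apply]
    simp only [Matrix.trace, Matrix.diag_apply, pairMap_single, Fintype.sum_prod_type]
    have h1 := trace_errorKind b (Matrix.single x1 y1 1)
    have h2 := trace_errorKind b' (Matrix.single x2 y2 1)
    rw [← Fintype.sum_mul_sum]
    simp only [Matrix.trace, Matrix.diag_apply] at h1 h2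
    rw [h1, h2, Fintype.sum_mul_sum]
    refine Finset.sum_congr rfl fun i _ => Finset.sum_congr rfl fun j _ => ?_
    rw [Matrix.single_apply, Matrix.single_apply, Matrix.single_apply, ite_zero_mul_ite_zero,
      mul_one]
    simp only [Prod.mk.injEq, and_and_and_comm]
  exact LinearMap.congr_fun h Y

/-- The weight with which a gate turns the error bit `b` of a qubit into `c`, if the error bit of
its partner turns from `b'` into `c'`. Equal error bits are kept by the twirl. Unequal ones become
`(0, 0)` with probability `1/5` and `(1, 1)` with probability `4/5`; the square root shares this
probability evenly between the two qubits of the pair, so that the probability of a transition is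
the product of the weights of all qubits. -/
noncomputable def twirlWeight (b b' c c' : Bool) : ℝ :=
  if b = b' then (if c = b then 1 else 0)
  else if c = c' then √(if c then 4 / 5 else 1 / 5) else 0

lemma twirlWeight_nonneg (b b' c c' : Bool) : 0 ≤ twirlWeight b b' c c' := by
  unfold twirlWeight
  split_ifs <;> positivity

/-- The probability with which a gate turns the error bits `b, b'` of its qubits into `c, c'`. -/
lemma twirlWeight_mul (b b' c c' : Bool) :
    twirlWeight b b' c c' * twirlWeight b' b c' c =
      if b = b' then (if c = b ∧ c' = b then 1 else 0)
      else if c = c' then (if c then 4 / 5 else 1 / 5) else 0 := by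
  cases b <;> cases b' <;> cases c <;> cases c' <;> simp [twirlWeight] <;>
    field_simp <;> norm_num

lemma haarTwirl_pairMap (b b' : Bool) (x y x' y' : Fin 2 × Fin 2) :
    haarTwirl (pairMap (errorKind b) (errorKind b')) (Matrix.single x' y' 1) x y =
      ∑ c, ∑ c', ((twirlWeight b b' c c' * twirlWeight b' b c' c : ℝ) : ℂ) *
        (errorKind c (Matrix.single x'.1 y'.1 1) x.1 y.1 *
          errorKind c' (Matrix.single x'.2 y'.2 1) x.2 y.2) := by
  have htr : LinearMap.trace ℂ PairOp (pairMap (errorKind b) (errorKind b')) =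
      (if b then 1 else 4) * (if b' then 1 else 4) := by
    rw [pair_trace_eq_sum]
    simp only [pairMap_single, errorKind_single]
    cases b <;> cases b' <;> simp [Fintype.sum_prod_type] <;> norm_num
  rw [haarTwirl_eq _ (trace_pairMap_errorKind b b'), htr]
  obtain ⟨x1, x2⟩ := x
  obtain ⟨y1, y2⟩ := y
  obtain ⟨x1', x2'⟩ := x'
  obtain ⟨y1', y2'⟩ := y'
  -- All entries are polynomials in the indicators `A i` and `B i` of the conditions that give
  -- nonzero entries of the erasure and of the identity on the two qubits.
  set A1 : ℂ := if x1' = y1' ∧ x1 = y1 then 1 else 0 with hA1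
  set A2 : ℂ := if x2' = y2' ∧ x2 = y2 then 1 else 0 with hA2
  set B1 : ℂ := if x1' = x1 ∧ y1' = y1 then 1 else 0 with hB1
  set B2 : ℂ := if x2' = x2 ∧ y2' = y2 then 1 else 0 with hB2
  have hE1 : ∀ e, errorKind e (Matrix.single x1' y1' 1) x1 y1 = if e then A1 / 2 else B1 := by
    intro e; rw [errorKind_single, hA1, hB1]; congr 1; split_ifs <;> simp
  have hE2 : ∀ e, errorKind e (Matrix.single x2' y2' 1) x2 y2 = if e then A2 / 2 else B2 := by
    intro e; rw [errorKind_single, hA2, hB2]; congr 1; split_ifs <;> simp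
  have hS : (Matrix.single (x1', x2') (y1', y2') (1 : ℂ) : PairOp) (x1, x2) (y1, y2) = B1 * B2 := by
    rw [Matrix.single_apply, hB1, hB2, ite_zero_mul_ite_zero, mul_one]
    simp only [Prod.mk.injEq, and_and_and_comm]
  have hT : (Matrix.single (x1', x2') (y1', y2') (1 : ℂ) : PairOp).trace
      * (1 : PairOp) (x1, x2) (y1, y2) = A1 * A2 := by
    have h1 : (Matrix.single (x1', x2') (y1', y2') (1 : ℂ) : PairOp).trace =
        if x1' = y1' ∧ x2' = y2' then 1 else 0 := by
      split_ifs with h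
      · rw [h.1, h.2, Matrix.trace_single_eq_same]
      · exact Matrix.trace_single_eq_of_ne _ _ _ (by simpa using h)
    rw [h1, Matrix.one_apply, hA1, hA2, ite_zero_mul_ite_zero, ite_zero_mul_ite_zero]
    simp only [Prod.mk.injEq, and_and_and_comm]
  simp only [Matrix.add_apply, Matrix.smul_apply, smul_eq_mul, mul_assoc, hT, hS, hE1, hE2,
    twirlWeight_mul, Fintype.sum_bool]
  cases b <;> cases b' <;> simp <;> ring

/-- Conjugation `X ↦ W X W†` of `n`-qubit operators. -/
def opConj {n : ℕ} (W : Op n) : Op n →ₗ[ℂ] Op n :=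
  LinearMap.mulRight ℂ W.conjTranspose ∘ₗ LinearMap.mulLeft ℂ W

lemma opConj_apply {n : ℕ} (W X : Op n) : opConj W X = W * X * W.conjTranspose := rfl

lemma opConj_conjTranspose_apply {n : ℕ} (W X : Op n) :
    opConj W.conjTranspose X = W.conjTranspose * X * W := by
  rw [opConj_apply, Matrix.conjTranspose_conjTranspose]

/-- Four sums over assignments of values to the sites are one sum over assignments of quadruples. -/
lemma sum_quadruple {ι A M : Type*} [Fintype ι] [DecidableEq ι] [Fintype A] [AddCommMonoid M]
    (H : (ι → A) → (ι → A) → (ι → A) → (ι → A) → M) :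
    ∑ a, ∑ b, ∑ c, ∑ d, H a b c d =
      ∑ q : ι → A × A × A × A, H (fun i => (q i).1) (fun i => (q i).2.1)
        (fun i => (q i).2.2.1) (fun i => (q i).2.2.2) := by
  let e : (ι → A × A × A × A) ≃ (ι → A) × (ι → A) × (ι → A) × (ι → A) :=
    { toFun := fun q => (fun i => (q i).1, fun i => (q i).2.1, fun i => (q i).2.2.1,
        fun i => (q i).2.2.2)
      invFun := fun r i => (r.1 i, r.2.1 i, r.2.2.1 i, r.2.2.2 i)
      left_inv := fun _ => rfl
      right_inv := fun _ => rfl }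
  refine Eq.trans ?_ (e.sum_comp fun r => H r.1 r.2.1 r.2.2.1 r.2.2.2).symm
  simp only [Fintype.sum_prod_type]

/-- Two sums over quadruples, one for each qubit of a pair, are four sums over pairs. -/
lemma sum_quadruple_pair {A M : Type*} [Fintype A] [AddCommMonoid M]
    (H : A × A → A × A → A × A → A × A → M) :
    ∑ s : A × A × A × A, ∑ t : A × A × A × A,
      H (s.1, t.1) (s.2.1, t.2.1) (s.2.2.1, t.2.2.1) (s.2.2.2, t.2.2.2) =
    ∑ a, ∑ b, ∑ c, ∑ d, H a b c d := by
  let e : (A × A × A × A) × (A × A × A × A) ≃ (A × A) × (A × A) × (A × A) × (A × A) :=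
    { toFun := fun q => ((q.1.1, q.2.1), (q.1.2.1, q.2.2.1), (q.1.2.2.1, q.2.2.2.1),
        (q.1.2.2.2, q.2.2.2.2))
      invFun := fun r => ((r.1.1, r.2.1.1, r.2.2.1.1, r.2.2.2.1),
        (r.1.2, r.2.1.2, r.2.2.1.2, r.2.2.2.2))
      left_inv := fun _ => rfl
      right_inv := fun _ => rfl }
  rw [← Fintype.sum_prod_type']
  refine (e.sum_comp fun r => H r.1 r.2.1 r.2.2.1 r.2.2.2).trans ?_
  rw [Fintype.sum_prod_type]
  refine Finset.sum_congr rfl fun a _ => ?_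
  rw [Fintype.sum_prod_type]
  exact Finset.sum_congr rfl fun b _ => Fintype.sum_prod_type _

lemma layerUnitary_apply {n : ℕ} (σ : Layer n) (u : Fin n → Gate) (x y : Fin n → Fin 2) :
    layerUnitary σ u x y = pairProd σ (fun i => (u i).1 (x i, x (σ.1 i)) (y i, y (σ.1 i)))
      (fun i => if x i = y i then 1 else 0) := rfl

/-- The conjugated error map factorizes over the pairs and the idle qubits of the layer. -/
lemma layer_conj_entry {n : ℕ} (σ : Layer n) (u : Fin n → Gate) (j : Fin n → Bool)
    (x' y' x y : Fin n → Fin 2) :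
    ((layerUnitary σ u).conjTranspose * errorMap j (layerUnitary σ u *
        Matrix.single x' y' (1 : ℂ) * (layerUnitary σ u).conjTranspose) * layerUnitary σ u :
        Op n) x y =
      pairProd σ
        (fun i => gateConj (u i)⁻¹ (pairMap (errorKind (j i)) (errorKind (j (σ.1 i)))
          (gateConj (u i) (Matrix.single (x' i, x' (σ.1 i)) (y' i, y' (σ.1 i)) 1)))
            (x i, x (σ.1 i)) (y i, y (σ.1 i)))
        (fun i => errorKind (j i) (Matrix.single (x' i) (y' i) 1) (x i) (y i)) := by
  have h := conj_twirl_entry (layerUnitary σ u) (tensorLin fun i => errorKind (j i)) x' y' x y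
  refine h.trans ?_
  simp only [tensorLin_apply, tensorMap_single, layerUnitary_apply, ← starRingEnd_apply,
    map_pairProd]
  simp only [prod_eq_pairProd σ, pairProd_mul]
  rw [sum_quadruple]
  refine Eq.trans ?_ ((sum_pairProd (T := Fin 2 × Fin 2 × Fin 2 × Fin 2) σ (fun i s t =>
    starRingEnd ℂ ((u i).1 (s.1, t.1) (x i, x (σ.1 i))) *
      (u i).1 (s.2.1, t.2.1) (y i, y (σ.1 i)) *
      ((u i).1 (s.2.2.1, t.2.2.1) (x' i, x' (σ.1 i)) *
        starRingEnd ℂ ((u i).1 (s.2.2.2, t.2.2.2) (y' i, y' (σ.1 i)))) *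
      (errorKind (j i) (Matrix.single s.2.2.1 s.2.2.2 1) s.1 s.2.1 *
        errorKind (j (σ.1 i)) (Matrix.single t.2.2.1 t.2.2.2 1) t.1 t.2.1))
    (fun i s => starRingEnd ℂ (if s.1 = x i then 1 else 0) * (if s.2.1 = y i then 1 else 0) *
      ((if s.2.2.1 = x' i then 1 else 0) * starRingEnd ℂ (if s.2.2.2 = y' i then 1 else 0)) *
      errorKind (j i) (Matrix.single s.2.2.1 s.2.2.2 1) s.1 s.2.1)).trans ?_)
  · exact Finset.sum_congr rfl fun q _ =>
      pairProd_congr σ (fun i _ => rfl) (fun i _ => rfl)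
  refine pairProd_congr σ (fun i _ => ?_) (fun i _ => ?_)
  · have h2 := conj_twirl_entry (u i).1 (pairMap (errorKind (j i)) (errorKind (j (σ.1 i))))
      (x' i, x' (σ.1 i)) (y' i, y' (σ.1 i)) (x i, x (σ.1 i)) (y i, y (σ.1 i))
    simp only [pairMap_single] at h2
    rw [gateConj_apply, gateConj_apply, ← mul_assoc, ← mul_assoc]
    have h3 : ((u i)⁻¹).1 = (u i).1.conjTranspose := rfl
    rw [h3, Matrix.star_eq_conjTranspose, Matrix.star_eq_conjTranspose,
      Matrix.conjTranspose_conjTranspose, h2]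
    exact sum_quadruple_pair fun a b a' b' =>
      starRingEnd ℂ ((u i).1 a (x i, x (σ.1 i))) * (u i).1 b (y i, y (σ.1 i)) *
      ((u i).1 a' (x' i, x' (σ.1 i)) * starRingEnd ℂ ((u i).1 b' (y' i, y' (σ.1 i)))) *
      (errorKind (j i) (Matrix.single a'.1 b'.1 1) a.1 b.1 *
        errorKind (j (σ.1 i)) (Matrix.single a'.2 b'.2 1) a.2 b.2)
  · rw [Finset.sum_eq_single (x i, y i, x' i, y' i)]
    · simp
    · rintro ⟨a, b, a', b'⟩ _ hne
      by_cases h1 : a = x i <;> by_cases h2 : b = y i <;> by_cases h3 : a' = x' i <;>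
        by_cases h4 : b' = y' i <;> simp_all
    · simp

/-- The law of the error pattern after the Haar twirl of a layer. -/
noncomputable def twirlStep {n : ℕ} (σ : Layer n) (π : (Fin n → Bool) → ℝ)
    (k : Fin n → Bool) : ℝ :=
  ∑ j, π j * ∏ i, twirlWeight (j i) (j (σ.1 i)) (k i) (k (σ.1 i))

lemma twirlWeight_idle (b c : Bool) : twirlWeight b b c c = if c = b then 1 else 0 := by
  simp [twirlWeight]

/-- The transition probabilities of the twirl factorize over the pairs and the idle qubits. -/
lemma prod_twirlWeight {n : ℕ} (σ : Layer n) (j k : Fin n → Bool) :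
    ∏ i, twirlWeight (j i) (j (σ.1 i)) (k i) (k (σ.1 i)) =
      pairProd σ (fun i => twirlWeight (j i) (j (σ.1 i)) (k i) (k (σ.1 i)) *
          twirlWeight (j (σ.1 i)) (j i) (k (σ.1 i)) (k i))
        (fun i => if k i = j i then 1 else 0) := by
  rw [prod_eq_pairProd σ]
  refine pairProd_congr σ (fun i _ => ?_) (fun i hi => ?_)
  · rw [σ.2]
  · rw [hi, twirlWeight_idle]

lemma continuous_layerUnitary {n : ℕ} (σ : Layer n) :
    Continuous fun u : Fin n → Gate => layerUnitary σ u := by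
  refine continuous_matrix fun x y => ?_
  simp only [layerUnitary_apply, pairProd]
  refine continuous_finsetProd _ fun i _ => ?_
  split_ifs
  · exact (continuous_subtype_val.comp (continuous_apply i)).matrix_elem _ _
  · exact continuous_const
  · exact continuous_const
  · exact continuous_const

lemma integrable_layer_conj {n : ℕ} (σ : Layer n) (j : Fin n → Bool) (X : Op n)
    (x y : Fin n → Fin 2) :
    Integrable (fun u : Fin n → Gate => ((layerUnitary σ u).conjTranspose *
      errorMap j (layerUnitary σ u * X * (layerUnitary σ u).conjTranspose) *
        layerUnitary σ u : Op n) x y) (Measure.pi fun _ => haarGate) := by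
  have hV := continuous_layerUnitary σ
  refine integrable_of_continuous_compact ?_
  have h1 := continuous_matrix_linearMap (tensorLin fun i => errorKind (j i))
    ((hV.matrix_mul (continuous_const (y := X))).matrix_mul hV.matrix_conjTranspose)
  exact ((hV.matrix_conjTranspose.matrix_mul h1).matrix_mul hV).matrix_elem x y

/-- The average of an error map over the conjugations by a layer of independent Haar-random
gates. -/
lemma layer_twirl {n : ℕ} (σ : Layer n) (j : Fin n → Bool) (X : Op n) (x y : Fin n → Fin 2) :
    ∫ u : Fin n → Gate, ((layerUnitary σ u).conjTranspose * errorMap j (layerUnitary σ u *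
        X * (layerUnitary σ u).conjTranspose) * layerUnitary σ u : Op n) x y
        ∂(Measure.pi fun _ => haarGate) =
      (∑ k, ((∏ i, twirlWeight (j i) (j (σ.1 i)) (k i) (k (σ.1 i)) : ℝ) : ℂ) •
        errorMap k X) x y := by
  -- Both sides are linear in `X`, so it suffices to treat the matrix units.
  have hunit : ∀ x' y', ∫ u : Fin n → Gate, ((layerUnitary σ u).conjTranspose *
      errorMap j (layerUnitary σ u * Matrix.single x' y' (1 : ℂ) *
        (layerUnitary σ u).conjTranspose) * layerUnitary σ u : Op n) x y
        ∂(Measure.pi fun _ => haarGate) =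
      (∑ k, ((∏ i, twirlWeight (j i) (j (σ.1 i)) (k i) (k (σ.1 i)) : ℝ) : ℂ) •
        errorMap k (Matrix.single x' y' 1)) x y := by
    intro x' y'
    simp only [layer_conj_entry, pairProd]
    rw [integral_fintype_prod_eq_prod fun i U => if i < σ.1 i then
      gateConj U⁻¹ (pairMap (errorKind (j i)) (errorKind (j (σ.1 i)))
          (gateConj U (Matrix.single (x' i, x' (σ.1 i)) (y' i, y' (σ.1 i)) 1)))
            (x i, x (σ.1 i)) (y i, y (σ.1 i))
      else if σ.1 i = i then errorKind (j i) (Matrix.single (x' i) (y' i) 1) (x i) (y i) else 1]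
    have hR := sum_pairProd σ
      (fun i c c' => ((twirlWeight (j i) (j (σ.1 i)) c c' * twirlWeight (j (σ.1 i)) (j i) c' c : ℝ)
        : ℂ) * (errorKind c (Matrix.single (x' i) (y' i) 1) (x i) (y i) *
          errorKind c' (Matrix.single (x' (σ.1 i)) (y' (σ.1 i)) 1) (x (σ.1 i)) (y (σ.1 i))))
      (fun i c => ((if c = j i then 1 else 0 : ℝ) : ℂ) *
        errorKind c (Matrix.single (x' i) (y' i) 1) (x i) (y i))
    simp only [Matrix.sum_apply, Matrix.smul_apply, errorMap_eq, tensorMap_single, smul_eq_mul]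
    simp only [prod_twirlWeight, ← Complex.ofRealHom_eq_coe, map_pairProd]
    simp only [prod_eq_pairProd σ (fun i => errorKind _ _ _ _), pairProd_mul]
    simp only [Complex.ofRealHom_eq_coe]
    refine Eq.trans ?_ hR.symm
    refine Finset.prod_congr rfl fun i _ => ?_
    split_ifs with h1 h2
    · exact haarTwirl_pairMap _ _ _ _ _ _
    · beta_reduce
      rw [integral_const, Finset.sum_eq_single (j i)]
      · simp
      · intro c _ hc; simp [hc]
      · simp
    · simp
  have hL : ∀ u : Fin n → Gate, ((layerUnitary σ u).conjTranspose * errorMap j (layerUnitary σ u *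
        X * (layerUnitary σ u).conjTranspose) * layerUnitary σ u : Op n) x y =
      ∑ x', ∑ y', X x' y' * ((layerUnitary σ u).conjTranspose * errorMap j (layerUnitary σ u *
        Matrix.single x' y' (1 : ℂ) * (layerUnitary σ u).conjTranspose) * layerUnitary σ u :
          Op n) x y := by
    intro u
    have := linearMap_apply_eq_sum (opConj (layerUnitary σ u).conjTranspose ∘ₗ
      (tensorLin fun i => errorKind (j i)) ∘ₗ opConj (layerUnitary σ u)) X x y
    simpa only [LinearMap.comp_apply, opConj_apply, Matrix.conjTranspose_conjTranspose,
      tensorLin_apply, ← errorMap_eq] using this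
  have hR : (∑ k, ((∏ i, twirlWeight (j i) (j (σ.1 i)) (k i) (k (σ.1 i)) : ℝ) : ℂ) •
        errorMap k X) x y = ∑ x', ∑ y', X x' y' *
      (∑ k, ((∏ i, twirlWeight (j i) (j (σ.1 i)) (k i) (k (σ.1 i)) : ℝ) : ℂ) •
        errorMap k (Matrix.single x' y' 1)) x y := by
    have := linearMap_apply_eq_sum (∑ k : Fin n → Bool,
      ((∏ i, twirlWeight (j i) (j (σ.1 i)) (k i) (k (σ.1 i)) : ℝ) : ℂ) •
        tensorLin fun i => errorKind (k i)) X x y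
    simpa only [LinearMap.sum_apply, LinearMap.smul_apply, tensorLin_apply,
      ← errorMap_eq] using this
  rw [hR]
  simp only [hL, ← hunit]
  refine (integral_finsetSum Finset.univ fun x' _ =>
    integrable_finsetSum Finset.univ fun y' _ =>
      (integrable_layer_conj σ j _ x y).const_mul (X x' y')).trans ?_
  refine Finset.sum_congr rfl fun x' _ => ?_
  refine (integral_finsetSum Finset.univ fun y' _ =>
    (integrable_layer_conj σ j _ x y).const_mul (X x' y')).trans ?_
  exact Finset.sum_congr rfl fun y' _ => integral_const_mul _ _

lemma IsMixture.layer_conj_apply {n : ℕ} {Φ : Op n → Op n} {π : (Fin n → Bool) → ℝ}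
    (h : IsMixture Φ π) (W Y X : Op n) (x y : Fin n → Fin 2) :
    (W * Φ X * Y : Op n) x y = ∑ j, (π j : ℂ) * (W * errorMap j X * Y : Op n) x y := by
  rw [h X, Matrix.mul_sum, Matrix.sum_mul, Matrix.sum_apply]
  refine Finset.sum_congr rfl fun j _ => ?_
  rw [Matrix.mul_smul, Matrix.smul_mul, Matrix.smul_apply, smul_eq_mul]

lemma IsMixture.integrable_layer_conj {n : ℕ} {Φ : Op n → Op n} {π : (Fin n → Bool) → ℝ}
    (h : IsMixture Φ π) (σ : Layer n) (X : Op n) (x y : Fin n → Fin 2) :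
    Integrable (fun u : Fin n → Gate => ((layerUnitary σ u).conjTranspose *
      Φ (layerUnitary σ u * X * (layerUnitary σ u).conjTranspose) *
        layerUnitary σ u : Op n) x y) (Measure.pi fun _ => haarGate) := by
  simp only [h.layer_conj_apply]
  exact integrable_finsetSum _ fun j _ =>
    (NoisyEcho.integrable_layer_conj σ j X x y).const_mul _

/-- The twirl of a mixture of error maps by a layer of gates is again such a mixture. -/
lemma IsMixture.layer_twirl {n : ℕ} {Φ : Op n → Op n} {π : (Fin n → Bool) → ℝ}
    (h : IsMixture Φ π) (σ : Layer n) :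
    IsMixture (fun X => Matrix.of fun x y => ∫ u : Fin n → Gate,
      ((layerUnitary σ u).conjTranspose *
        Φ (layerUnitary σ u * X * (layerUnitary σ u).conjTranspose) *
          layerUnitary σ u : Op n) x y ∂(Measure.pi fun _ => haarGate)) (twirlStep σ π) := by
  intro X
  ext x y
  simp only [Matrix.of_apply, h.layer_conj_apply]
  refine (integral_finsetSum Finset.univ fun j _ =>
    (NoisyEcho.integrable_layer_conj σ j X x y).const_mul (π j : ℂ)).trans ?_
  refine (Finset.sum_congr rfl fun j _ => (integral_const_mul _ _).trans
    (congrArg ((π j : ℂ) * ·) (NoisyEcho.layer_twirl σ j X x y))).trans ?_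
  simp only [Matrix.sum_apply, Matrix.smul_apply, smul_eq_mul, twirlStep, Complex.ofReal_sum,
    Complex.ofReal_mul, Finset.mul_sum, Finset.sum_mul, mul_assoc]
  exact Finset.sum_comm

/-! ### The error law of a circuit -/

/-- The law of the error pattern without any error. -/
def cleanLaw {n : ℕ} (j : Fin n → Bool) : ℝ := if j = fun _ => false then 1 else 0

/-- The law of the error pattern of the averaged circuit with gate pattern `S`, built from the
innermost layer outwards. The layers inside the outermost gates are always preceded by noise, so
that they follow the convention `pre = true`. -/
noncomputable def circuitLaw {n : ℕ} (p : ℝ) :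
    {m : ℕ} → Bool → (Fin m → Layer n) → (Fin n → Bool) → ℝ
  | 0, pre, _ => if pre then noiseStep p cleanLaw else cleanLaw
  | _ + 1, pre, S =>
    if pre then noiseStep p (noiseStep p (twirlStep (S 0) (circuitLaw p true fun t => S t.succ)))
    else noiseStep p (twirlStep (S 0) (circuitLaw p true fun t => S t.succ))

lemma circuit_zero {n : ℕ} (p : ℝ) (pre : Bool) (S : Fin 0 → Layer n) (U : Fin 0 → Fin n → Gate)
    (X : Op n) : circuit p pre S U X = if pre then noiseLayer p X else X := by
  simp [circuit, entangle, uncompute]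

lemma circuit_succ {n m : ℕ} (p : ℝ) (pre : Bool) (S : Fin (m + 1) → Layer n)
    (U : Fin (m + 1) → Fin n → Gate) (X : Op n) :
    circuit p pre S U X = noiseLayer p ((layerUnitary (S 0) (U 0)).conjTranspose *
      circuit p true (fun t => S t.succ) (fun t => U t.succ)
        (layerUnitary (S 0) (U 0) * (if pre then noiseLayer p X else X) *
          (layerUnitary (S 0) (U 0)).conjTranspose) * layerUnitary (S 0) (U 0)) := by
  simp [circuit, entangle, uncompute, List.ofFn_succ]

lemma continuous_noiseLayer {n : ℕ} (p : ℝ) {Ω : Type*} [TopologicalSpace Ω] {Y : Ω → Op n}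
    (hY : Continuous Y) : Continuous fun ω => noiseLayer p (Y ω) :=
  continuous_matrix_linearMap (tensorLin fun _ => depolarizing p) hY

lemma continuous_circuit {n m : ℕ} (p : ℝ) (pre : Bool) (S : Fin m → Layer n) {Ω : Type*}
    [TopologicalSpace Ω] {U : Ω → Fin m → Fin n → Gate} {Y : Ω → Op n} (hU : Continuous U)
    (hY : Continuous Y) : Continuous fun ω => circuit p pre S (U ω) (Y ω) := by
  induction m generalizing pre Y with
  | zero =>
    simp only [circuit_zero]
    cases pre
    · simpa using hY
    · simpa using continuous_noiseLayer p hY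
  | succ m ih =>
    simp only [circuit_succ]
    have hV : Continuous fun ω => layerUnitary (S 0) (U ω 0) :=
      (continuous_layerUnitary (S 0)).comp ((continuous_apply 0).comp hU)
    have hX : Continuous fun ω => if pre then noiseLayer p (Y ω) else Y ω := by
      cases pre
      · simpa using hY
      · simpa using continuous_noiseLayer p hY
    exact continuous_noiseLayer p ((hV.matrix_conjTranspose.matrix_mul
      (ih true (fun t => S t.succ) (U := fun ω t => U ω t.succ) (by fun_prop)
        ((hV.matrix_mul hX).matrix_mul hV.matrix_conjTranspose))).matrix_mul hV)

/-- Independence of the gates of the first layer from those of the other ones. -/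
lemma integral_gates_succ {n m : ℕ} (g : (Fin n → Gate) × (Fin m → Fin n → Gate) → ℂ)
    (hg : Continuous g) :
    ∫ U : Fin (m + 1) → Fin n → Gate, g (U 0, fun t => U t.succ)
        ∂(Measure.pi fun _ => Measure.pi fun _ => haarGate) =
      ∫ u : Fin n → Gate, ∫ U : Fin m → Fin n → Gate, g (u, U)
        ∂(Measure.pi fun _ => Measure.pi fun _ => haarGate) ∂(Measure.pi fun _ => haarGate) := by
  have h := (measurePreserving_piFinSuccAbove
    (fun _ : Fin (m + 1) => (Measure.pi fun _ : Fin n => haarGate)) 0).integral_comp' g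
  rw [← integral_prod g (integrable_of_continuous_compact hg)]
  exact h

/-- The Haar average of a circuit is the mixture of error maps given by `circuitLaw`. -/
lemma haarAverage_isMixture {n m : ℕ} (p : ℝ) (pre : Bool) (S : Fin m → Layer n) :
    IsMixture (haarAverage p pre S) (circuitLaw p pre S) := by
  have hclean : IsMixture (fun X : Op n => X) cleanLaw := by
    intro X
    rw [Finset.sum_eq_single fun _ => false]
    · have := linearMap_ext_single (L := LinearMap.id)
        (L' := tensorLin fun _ : Fin n => LinearMap.id) (fun a b x y => ?_) X
      · simpa [cleanLaw, errorMap_eq, errorKind, tensorLin_apply] using this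
      · rw [tensorLin_apply, tensorMap_single]
        simp only [LinearMap.id_apply, Matrix.single_apply, funext_iff, Finset.prod_ite_zero,
          Finset.prod_const_one, Finset.mem_univ, true_imp_iff, forall_and]
    · intro j _ hj; simp [cleanLaw, hj]
    · simp
  induction m generalizing pre with
  | zero =>
    have h0 : haarAverage p pre S = fun X => if pre then noiseLayer p X else X := by
      funext X
      ext x y
      simp [haarAverage, circuit_zero]
    rw [h0]
    cases pre
    · simpa [circuitLaw] using hclean
    · simpa [circuitLaw] using hclean.noise_comp p
  | succ m ih =>
    have hin := ih true fun t => S t.succ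
    have hTw := hin.layer_twirl (S 0)
    have hstep : ∀ X, haarAverage p pre S X = noiseLayer p (Matrix.of fun x y =>
        ∫ u : Fin n → Gate, ((layerUnitary (S 0) u).conjTranspose *
          haarAverage p true (fun t => S t.succ) (layerUnitary (S 0) u *
            (if pre then noiseLayer p X else X) * (layerUnitary (S 0) u).conjTranspose) *
            layerUnitary (S 0) u : Op n) x y ∂(Measure.pi fun _ => haarGate)) := by
      intro X
      generalize hX : (if pre then noiseLayer p X else X) = X₀
      ext x y
      have hV := continuous_layerUnitary (S 0)
      have hcirc : Continuous fun q : (Fin n → Gate) × (Fin m → Fin n → Gate) =>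
          circuit p true (fun t => S t.succ) q.2
            (layerUnitary (S 0) q.1 * X₀ * (layerUnitary (S 0) q.1).conjTranspose) := by
        have hV1 := hV.comp (continuous_fst (X := Fin n → Gate) (Y := Fin m → Fin n → Gate))
        exact continuous_circuit p true _ continuous_snd
          ((hV1.matrix_mul continuous_const).matrix_mul hV1.matrix_conjTranspose)
      have h1 := integral_gates_succ (fun q : (Fin n → Gate) × (Fin m → Fin n → Gate) =>
        noiseLayer p ((layerUnitary (S 0) q.1).conjTranspose *
          circuit p true (fun t => S t.succ) q.2
            (layerUnitary (S 0) q.1 * X₀ * (layerUnitary (S 0) q.1).conjTranspose) *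
          layerUnitary (S 0) q.1) x y) (by
          have hV1 := hV.comp (continuous_fst (X := Fin n → Gate) (Y := Fin m → Fin n → Gate))
          exact (continuous_noiseLayer p ((hV1.matrix_conjTranspose.matrix_mul hcirc).matrix_mul
            hV1)).matrix_elem x y)
      have h2 := linearMap_integral_entries (μ := Measure.pi fun _ : Fin n => haarGate)
        (tensorLin fun _ : Fin n => depolarizing p) (fun u =>
        (layerUnitary (S 0) u).conjTranspose *
          haarAverage p true (fun t => S t.succ) (layerUnitary (S 0) u *
            X₀ * (layerUnitary (S 0) u).conjTranspose) * layerUnitary (S 0) u)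
        (fun a b => hin.integrable_layer_conj (S 0) X₀ a b) x y
      refine Eq.trans ?_ h2.symm
      simp only [haarAverage, Matrix.of_apply, circuit_succ, hX]
      refine h1.trans (integral_congr_ae (Filter.Eventually.of_forall fun u => ?_))
      have h3 := linearMap_integral_entries
        (μ := Measure.pi fun _ : Fin m => Measure.pi fun _ : Fin n => haarGate)
        ((tensorLin fun _ : Fin n => depolarizing p) ∘ₗ
          opConj (layerUnitary (S 0) u).conjTranspose)
        (fun U => circuit p true (fun t => S t.succ) U
          (layerUnitary (S 0) u * X₀ * (layerUnitary (S 0) u).conjTranspose))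
        (fun a b => integrable_of_continuous_compact
          ((continuous_circuit p true _ continuous_id continuous_const).matrix_elem a b)) x y
      simp only [LinearMap.comp_apply, opConj_conjTranspose_apply] at h3
      exact h3.symm
    intro X
    rw [hstep]
    cases pre
    · simpa [circuitLaw] using (hTw.noise_comp p) X
    · simpa [circuitLaw] using ((hTw.comp_noise p).noise_comp p) X

/-! ### Probability and symmetry of the error laws -/

/-- Probability vectors on the set of error patterns. -/
def IsProbVector {n : ℕ} (π : (Fin n → Bool) → ℝ) : Prop := (∀ j, 0 ≤ π j) ∧ ∑ j, π j = 1

lemma isProbVector_cleanLaw {n : ℕ} : IsProbVector (cleanLaw (n := n)) := by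
  refine ⟨fun j => ?_, by simp [cleanLaw]⟩
  unfold cleanLaw
  split_ifs <;> norm_num

/-- A stochastic matrix maps probability vectors to probability vectors. -/
lemma IsProbVector.step {n : ℕ} {π : (Fin n → Bool) → ℝ} (h : IsProbVector π)
    {q : (Fin n → Bool) → (Fin n → Bool) → ℝ} (hq : ∀ j k, 0 ≤ q j k)
    (hq1 : ∀ j, ∑ k, q j k = 1) : IsProbVector fun k => ∑ j, π j * q j k := by
  refine ⟨fun k => Finset.sum_nonneg fun j _ => mul_nonneg (h.1 j) (hq j k), ?_⟩
  rw [Finset.sum_comm]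
  simp only [← Finset.mul_sum, hq1, mul_one, h.2]

lemma IsProbVector.noiseStep {n : ℕ} {p : ℝ} (hp0 : 0 ≤ p) (hp1 : p ≤ 1)
    {π : (Fin n → Bool) → ℝ} (h : IsProbVector π) : IsProbVector (noiseStep p π) := by
  refine h.step (fun j k => Finset.prod_nonneg fun i _ => ?_) (fun j => ?_)
  · unfold noiseWeight
    split_ifs <;> linarith
  · rw [← Fintype.prod_sum (f := fun i b => noiseWeight p (j i) b)]
    refine Finset.prod_eq_one fun i _ => ?_
    cases j i <;> simp [noiseWeight]

lemma IsProbVector.twirlStep {n : ℕ} (σ : Layer n)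
    {π : (Fin n → Bool) → ℝ} (h : IsProbVector π) : IsProbVector (twirlStep σ π) := by
  refine h.step (fun j k => Finset.prod_nonneg fun i _ => twirlWeight_nonneg _ _ _ _)
    (fun j => ?_)
  simp only [prod_twirlWeight]
  rw [sum_pairProd σ (fun i c c' => twirlWeight (j i) (j (σ.1 i)) c c' *
    twirlWeight (j (σ.1 i)) (j i) c' c) (fun i c => if c = j i then 1 else 0)]
  refine Finset.prod_eq_one fun i _ => ?_
  split_ifs
  · simp only [twirlWeight_mul, Fintype.sum_bool]
    cases j i <;> cases j (σ.1 i) <;> simp <;> norm_num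
  · simp
  · rfl

lemma isProbVector_circuitLaw {n m : ℕ} {p : ℝ} (hp0 : 0 ≤ p) (hp1 : p ≤ 1) (pre : Bool)
    (S : Fin m → Layer n) : IsProbVector (circuitLaw p pre S) := by
  induction m generalizing pre with
  | zero =>
    cases pre
    · simpa [circuitLaw] using isProbVector_cleanLaw
    · simpa [circuitLaw] using isProbVector_cleanLaw.noiseStep hp0 hp1
  | succ m ih =>
    have h := ((ih true fun t => S t.succ).twirlStep (S 0)).noiseStep hp0 hp1
    cases pre
    · simpa [circuitLaw] using h
    · simpa [circuitLaw] using h.noiseStep hp0 hp1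

/-- Relabelling of the qubits of an error pattern, as an equivalence. -/
def patternEquiv {n : ℕ} (g : Equiv.Perm (Fin n)) : (Fin n → Bool) ≃ (Fin n → Bool) where
  toFun j := j ∘ g
  invFun j := j ∘ g.symm
  left_inv j := by ext; simp
  right_inv j := by ext; simp

lemma noiseStep_comp {n : ℕ} (p : ℝ) (π : (Fin n → Bool) → ℝ) (g : Equiv.Perm (Fin n))
    (l : Fin n → Bool) : noiseStep p (fun j => π (j ∘ g)) l = noiseStep p π (l ∘ g) := by
  refine Fintype.sum_equiv (patternEquiv g) _ _ fun k => ?_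
  rw [← Equiv.prod_comp g]
  rfl

lemma twirlStep_comp {n m : ℕ} (S : Fin m → Layer n) (t : Fin m) (π : (Fin n → Bool) → ℝ)
    (g : Equiv.Perm (Fin n)) (l : Fin n → Bool) :
    twirlStep (relabel g S t) (fun j => π (j ∘ g)) l = twirlStep (S t) π (l ∘ g) := by
  refine Fintype.sum_equiv (patternEquiv g) _ _ fun k => ?_
  rw [← Equiv.prod_comp g]
  simp [relabel, patternEquiv]

/-- Relabelling the qubits of a gate pattern relabels its error law. -/
lemma circuitLaw_relabel {n m : ℕ} (p : ℝ) (pre : Bool) (S : Fin m → Layer n)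
    (g : Equiv.Perm (Fin n)) :
    circuitLaw p pre (relabel g S) = fun j => circuitLaw p pre S (j ∘ g) := by
  have hclean : (cleanLaw : (Fin n → Bool) → ℝ) = fun j => cleanLaw (j ∘ g) := by
    funext j
    have : j = (fun _ => false) ↔ j ∘ g = fun _ => false := by
      constructor
      · rintro rfl; rfl
      · intro h
        funext i
        simpa using congrFun h (g.symm i)
    simp only [cleanLaw, this]
  induction m generalizing pre with
  | zero =>
    have h : noiseStep p (cleanLaw : (Fin n → Bool) → ℝ) =
        fun j => noiseStep p cleanLaw (j ∘ g) := by
      funext l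
      rw [← noiseStep_comp, ← hclean]
    cases pre
    · simpa [circuitLaw] using hclean
    · simpa [circuitLaw] using h
  | succ m ih =>
    have h1 : circuitLaw p true (fun t : Fin m => relabel g S t.succ) =
        fun j => circuitLaw p true (fun t : Fin m => S t.succ) (j ∘ g) :=
      ih true fun t => S t.succ
    have h2 : twirlStep (relabel g S 0) (circuitLaw p true fun t : Fin m => relabel g S t.succ) =
        fun l => twirlStep (S 0) (circuitLaw p true fun t : Fin m => S t.succ) (l ∘ g) := by
      rw [h1]
      exact funext fun l => twirlStep_comp S 0 _ g l
    have h3 : ∀ {π π' : (Fin n → Bool) → ℝ}, (π = fun j => π' (j ∘ g)) →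
        noiseStep p π = fun j => noiseStep p π' (j ∘ g) := by
      rintro π π' rfl
      exact funext fun l => noiseStep_comp p π' g l
    cases pre
    · simpa [circuitLaw] using h3 h2
    · simpa [circuitLaw] using h3 (h3 h2)

/-- The error law of an architecture. -/
noncomputable def avgLaw {n m : ℕ} (p : ℝ) (pre : Bool) (A : Architecture n m)
    (j : Fin n → Bool) : ℝ := ∑ S, (A S).toReal * circuitLaw p pre S j

lemma avgLaw_isErrorLaw {n m : ℕ} {p : ℝ} (hp0 : 0 ≤ p) (hp1 : p ≤ 1) (pre : Bool)
    (A : Architecture n m) : IsErrorLaw (avgChannel p pre A) (avgLaw p pre A) where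
  nonneg j := Finset.sum_nonneg fun S _ =>
    mul_nonneg ENNReal.toReal_nonneg ((isProbVector_circuitLaw hp0 hp1 pre S).1 j)
  sum_eq_one := by
    have hA : ∑ S, (A S).toReal = 1 := by
      rw [← ENNReal.toReal_sum fun S _ => A.apply_ne_top S, ← tsum_fintype (L := .unconditional _),
        A.tsum_coe, ENNReal.toReal_one]
    simp only [avgLaw]
    rw [Finset.sum_comm]
    simp only [← Finset.mul_sum, (isProbVector_circuitLaw hp0 hp1 pre _).2, mul_one, hA]
  eq_mixture X := by
    simp only [avgChannel, haarAverage_isMixture p pre _ X, avgLaw, Complex.ofReal_sum,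
      Complex.ofReal_mul, Finset.sum_smul, Finset.smul_sum, smul_smul]
    exact Finset.sum_comm

lemma relabel_injective {n m : ℕ} (g : Equiv.Perm (Fin n)) :
    Function.Injective (relabel (m := m) g) := by
  intro S T h
  funext t
  have := congrArg Subtype.val (congrFun h t)
  exact Subtype.ext (mul_left_cancel (mul_right_cancel this))

/-- The error law inherits the symmetries of the architecture. -/
lemma avgLaw_comp {n m : ℕ} (p : ℝ) (pre : Bool) {A : Architecture n m}
    {g : Equiv.Perm (Fin n)} (hg : A.map (relabel g) = A) (j : Fin n → Bool) :
    avgLaw p pre A (j ∘ g) = avgLaw p pre A j := by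
  have hA : ∀ S, A (relabel g S) = A S := by
    intro S
    conv_lhs => rw [← hg]
    rw [PMF.map_apply, tsum_eq_single S]
    · simp
    · intro T hT
      rw [if_neg]
      exact fun h => hT (relabel_injective g h).symm
  refine Fintype.sum_equiv (Equiv.ofBijective (relabel g)
    (Finite.injective_iff_bijective.mp (relabel_injective g))) _ _ fun S => ?_
  rw [Equiv.ofBijective_apply, hA, circuitLaw_relabel]

/-! ### Expectation values of products of Pauli `Z` operators -/

/-- The expectation value `tr(Z_T X)` of the product `Z_T` of the Pauli operators `Z_i`, `i ∈ T`. -/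
def zExp {n : ℕ} (T : Finset (Fin n)) (X : Op n) : ℂ :=
  ∑ x, (∏ i, if i ∈ T then (-1 : ℂ) ^ (x i : ℕ) else 1) * X x x

/-- The probability that an error pattern with law `π` has no error in `T`. -/
def cleanProb {n : ℕ} (π : (Fin n → Bool) → ℝ) (T : Finset (Fin n)) : ℝ :=
  ∑ j, π j * if ∀ i ∈ T, j i = false then 1 else 0

/-- `Z_T` is annihilated by the errors that meet `T`, and is fixed by the other ones. -/
lemma zExp_errorMap {n : ℕ} (T : Finset (Fin n)) (j : Fin n → Bool) (X : Op n) :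
    zExp T (errorMap j X) = (if ∀ i ∈ T, j i = false then 1 else 0) * zExp T X := by
  have hloc : ∀ (i : Fin n) (a b : Fin 2),
      ∑ c : Fin 2, (if i ∈ T then (-1 : ℂ) ^ (c : ℕ) else 1) *
        errorKind (j i) (Matrix.single a b 1) c c =
      (if i ∈ T → j i = false then 1 else 0) * ((if i ∈ T then (-1 : ℂ) ^ (a : ℕ) else 1) *
        if a = b then 1 else 0) := by
    intro i a b
    simp only [errorKind_single]
    by_cases hi : i ∈ T <;> cases j i <;> fin_cases a <;> fin_cases b <;> simp [hi]
  have hprod : ∀ x' y' : Fin n → Fin 2,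
      ∑ x : Fin n → Fin 2, (∏ i, if i ∈ T then (-1 : ℂ) ^ (x i : ℕ) else 1) *
        ∏ i, errorKind (j i) (Matrix.single (x' i) (y' i) 1) (x i) (x i) =
      (if ∀ i ∈ T, j i = false then 1 else 0) *
        ((∏ i, if i ∈ T then (-1 : ℂ) ^ (x' i : ℕ) else 1) * if x' = y' then 1 else 0) := by
    intro x' y'
    simp only [← Finset.prod_mul_distrib]
    rw [← Fintype.prod_sum (f := fun i (c : Fin 2) => (if i ∈ T then (-1 : ℂ) ^ (c : ℕ) else 1) *
        errorKind (j i) (Matrix.single (x' i) (y' i) 1) c c)]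
    simp only [hloc, Finset.prod_mul_distrib]
    rw [Finset.prod_ite_zero, Finset.prod_ite_zero]
    simp [funext_iff]
  have hx : ∀ x' y' : Fin n → Fin 2, X x' y' *
      ∑ x : Fin n → Fin 2, (∏ i, if i ∈ T then (-1 : ℂ) ^ (x i : ℕ) else 1) *
        ∏ i, errorKind (j i) (Matrix.single (x' i) (y' i) 1) (x i) (x i) =
      (if x' = y' then (if ∀ i ∈ T, j i = false then 1 else 0) *
        ((∏ i, if i ∈ T then (-1 : ℂ) ^ (x' i : ℕ) else 1) * X x' x') else 0) := by
    intro x' y'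
    rw [hprod]
    by_cases h : x' = y'
    · subst h
      simp only [if_true]
      ring
    · simp [h]
  calc zExp T (errorMap j X) = ∑ x', ∑ y', X x' y' *
      ∑ x : Fin n → Fin 2, (∏ i, if i ∈ T then (-1 : ℂ) ^ (x i : ℕ) else 1) *
        ∏ i, errorKind (j i) (Matrix.single (x' i) (y' i) 1) (x i) (x i) := by
        simp only [zExp, errorMap_eq, tensorMap_apply, Finset.mul_sum]
        rw [Finset.sum_comm]
        refine Finset.sum_congr rfl fun x' _ => ?_
        rw [Finset.sum_comm]
        refine Finset.sum_congr rfl fun y' _ => Finset.sum_congr rfl fun x _ => ?_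
        ring
    _ = _ := by
        simp only [hx, Finset.sum_ite_eq, Finset.mem_univ, if_true, zExp, Finset.mul_sum]

lemma zExp_mixture {n : ℕ} {Φ : Op n → Op n} {π : (Fin n → Bool) → ℝ} (h : IsErrorLaw Φ π)
    (T : Finset (Fin n)) (X : Op n) : zExp T (Φ X) = (cleanProb π T : ℂ) * zExp T X := by
  have h1 : zExp T (Φ X) = ∑ j, (π j : ℂ) * zExp T (errorMap j X) := by
    rw [h.eq_mixture X]
    simp only [zExp, Matrix.sum_apply, Matrix.smul_apply, smul_eq_mul, Finset.mul_sum]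
    rw [Finset.sum_comm]
    refine Finset.sum_congr rfl fun j _ => Finset.sum_congr rfl fun x _ => ?_
    ring
  rw [h1, cleanProb, Complex.ofReal_sum, Finset.sum_mul]
  refine Finset.sum_congr rfl fun j _ => ?_
  rw [zExp_errorMap]
  split_ifs <;> simp

/-- The expectation values of the products `Z_T` in the state `|0…0⟩` determine the error law: they
are the sums of the law over the lower sets `{j' | j' ≤ j}`. -/
lemma errorLaw_unique {n : ℕ} {Φ : Op n → Op n} {π π' : (Fin n → Bool) → ℝ}
    (h : IsErrorLaw Φ π) (h' : IsErrorLaw Φ π') : π = π' := by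
  have hT : ∀ T, cleanProb π T = cleanProb π' T := by
    intro T
    have h0 : zExp T (Matrix.single (fun _ => 0) (fun _ => 0) (1 : ℂ) : Op n) = 1 := by
      rw [zExp, Finset.sum_eq_single fun _ => 0]
      · simp
      · intro x _ hx; simp [Ne.symm hx]
      · simp
    have h1 := (zExp_mixture h T (Matrix.single (fun _ => 0) (fun _ => 0) 1)).symm.trans
      (zExp_mixture h' T (Matrix.single (fun _ => 0) (fun _ => 0) 1))
    rw [h0, mul_one, mul_one] at h1
    exact_mod_cast h1
  classical
  funext j
  induction j using WellFoundedLT.induction with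
  | ind j ih =>
    have hle : ∀ k : Fin n → Bool, (∀ i ∈ Finset.univ.filter fun i => j i = false, k i = false) ↔
        k ≤ j := by
      intro k
      simp only [Finset.mem_filter, Finset.mem_univ, true_and, Pi.le_def]
      refine forall_congr' fun i => ?_
      cases j i <;> cases k i <;> simp
    have h1 := hT (Finset.univ.filter fun i => j i = false)
    have hsum : ∀ ν : (Fin n → Bool) → ℝ, cleanProb ν (Finset.univ.filter fun i => j i = false) =
        ∑ k, ν k * if k ≤ j then 1 else 0 := fun ν =>
      Finset.sum_congr rfl fun k _ => congrArg (ν k * ·) (if_congr (hle k) rfl rfl)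
    rw [hsum, hsum] at h1
    rw [← Finset.add_sum_erase _ _ (Finset.mem_univ j),
      ← Finset.add_sum_erase (a := j) _ (fun k => π' k * if k ≤ j then 1 else 0)
        (Finset.mem_univ j)] at h1
    have h2 : ∑ k ∈ Finset.univ.erase j, (π k * if k ≤ j then 1 else 0) =
        ∑ k ∈ Finset.univ.erase j, π' k * if k ≤ j then 1 else 0 := by
      refine Finset.sum_congr rfl fun k hk => ?_
      split_ifs with hkj
      · rw [ih k (lt_of_le_of_ne hkj (Finset.ne_of_mem_erase hk))]
      · simp
    rw [h2] at h1
    simpa using add_right_cancel h1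

/-! ### The energy bound -/

lemma trace_costOp_mul {n : ℕ} (a : Matrix (Fin n) (Fin n) ℝ) (Y : Op n) :
    (costOp a * Y).trace =
      1 / 2 * ∑ i, ∑ k ∈ Finset.Ioi i, (a i k : ℂ) * (zExp ∅ Y - zExp {i, k} Y) := by
  rw [costOp, Matrix.smul_mul, Matrix.trace_smul, smul_eq_mul, Finset.sum_mul, Matrix.trace_sum]
  congr 1
  refine Finset.sum_congr rfl fun i _ => ?_
  rw [Finset.sum_mul, Matrix.trace_sum]
  refine Finset.sum_congr rfl fun k hk => ?_
  have hik : i ≠ k := (Finset.mem_Ioi.mp hk).ne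
  rw [Matrix.smul_mul, Matrix.trace_smul, smul_eq_mul, sub_mul, one_mul, Matrix.trace_sub]
  congr 2
  · simp [zExp, Matrix.trace]
  · rw [pauliZ, pauliZ, Matrix.diagonal_mul_diagonal, zExp, Matrix.trace]
    refine Finset.sum_congr rfl fun x _ => ?_
    rw [Matrix.diag_apply, Matrix.diagonal_mul, Fintype.prod_ite_mem, Finset.prod_pair hik]

lemma avgCut_eq {n : ℕ} (a : Matrix (Fin n) (Fin n) ℝ) :
    avgCut a = 1 / 2 * ∑ i, ∑ k ∈ Finset.Ioi i, a i k := by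
  have h0 : zExp ∅ (1 : Op n) = 2 ^ n := by simp [zExp]
  have h1 : ∀ i k : Fin n, zExp {i, k} (1 : Op n) = 0 := by
    intro i k
    simp only [zExp, Matrix.one_apply_eq, mul_one]
    rw [← Fintype.prod_sum (f := fun l (c : Fin 2) =>
      if l ∈ ({i, k} : Finset (Fin n)) then (-1 : ℂ) ^ (c : ℕ) else 1)]
    exact Finset.prod_eq_zero (Finset.mem_univ i) (by simp)
  have h2 := trace_costOp_mul a 1
  simp only [mul_one, h0, h1, sub_zero, ← Finset.sum_mul] at h2
  have h3 : (costOp a).trace = ((1 / 2 * (∑ i, ∑ k ∈ Finset.Ioi i, a i k) * 2 ^ n : ℝ) : ℂ) := by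
    rw [h2]; push_cast; ring
  rw [avgCut, h3, Complex.ofReal_re, mul_div_assoc, div_self (by positivity), mul_one]

/-- If the error bits of all qubits have the same probability `f` of being clean, then a cut that
is seen through the erasures obeys the energy bound. The maximum cut is compared with the given
cut `z`, with weight `(1/2 + f) / (1 + f)`, and with the cut that results from `z` by flipping the
clean qubits of a random error pattern, with weight `(1/2) / (1 + f)`. In the resulting inequality
the contribution of every edge is nonnegative. -/
lemma cut_bound {n : ℕ} {a : Matrix (Fin n) (Fin n) ℝ} (ha0 : ∀ i j, 0 ≤ a i j)
    {π : (Fin n → Bool) → ℝ} (hπ : IsProbVector π) {f : ℝ} (hf0 : 0 ≤ f) (hf1 : f ≤ 1)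
    (hf : ∀ i, cleanProb π {i} = f) (z : Fin n → ℤˣ) :
    1 / 2 * ∑ i, ∑ k ∈ Finset.Ioi i,
        a i k * (1 - cleanProb π {i, k} * (((z i : ℤ) : ℝ) * ((z k : ℤ) : ℝ))) ≤
      1 / 2 * f * (1 + f) * maxCut a + (1 - f ^ 2) * avgCut a := by
  have hmax : ∀ w : Fin n → ℤˣ, cost a w ≤ maxCut a := fun w =>
    Finset.le_sup' (cost a) (Finset.mem_univ w)
  let w : (Fin n → Bool) → Fin n → ℤˣ := fun j i => if j i = false then -z i else z i
  have hw : ∑ j, π j * cost a (w j) ≤ maxCut a := by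
    calc ∑ j, π j * cost a (w j) ≤ ∑ j, π j * maxCut a :=
          Finset.sum_le_sum fun j _ => mul_le_mul_of_nonneg_left (hmax _) (hπ.1 j)
      _ = maxCut a := by rw [← Finset.sum_mul, hπ.2, one_mul]
  have hwsum : ∑ j, π j * cost a (w j) = 1 / 2 * ∑ i, ∑ k ∈ Finset.Ioi i, a i k *
      (1 - ((z i : ℤ) : ℝ) * ((z k : ℤ) : ℝ) * (1 - 4 * f + 4 * cleanProb π {i, k})) := by
    have hedge : ∀ i k, ∑ j, π j * (1 - ((w j i : ℤ) : ℝ) * ((w j k : ℤ) : ℝ)) =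
        1 - ((z i : ℤ) : ℝ) * ((z k : ℤ) : ℝ) * (1 - 4 * f + 4 * cleanProb π {i, k}) := by
      intro i k
      have hpt : ∀ j, π j * (1 - ((w j i : ℤ) : ℝ) * ((w j k : ℤ) : ℝ)) =
          (1 - ((z i : ℤ) : ℝ) * ((z k : ℤ) : ℝ)) * π j
          + 2 * (((z i : ℤ) : ℝ) * ((z k : ℤ) : ℝ)) *
            ((π j * if ∀ l ∈ ({i} : Finset (Fin n)), j l = false then 1 else 0)
            + (π j * if ∀ l ∈ ({k} : Finset (Fin n)), j l = false then 1 else 0))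
          - 4 * (((z i : ℤ) : ℝ) * ((z k : ℤ) : ℝ)) *
            (π j * if ∀ l ∈ ({i, k} : Finset (Fin n)), j l = false then 1 else 0) := by
        intro j
        cases hi : j i <;> cases hk : j k <;> simp [w, hi, hk] <;> ring
      have hi := hf i
      have hk := hf k
      rw [Finset.sum_congr rfl fun j _ => hpt j, Finset.sum_sub_distrib, Finset.sum_add_distrib,
        ← Finset.mul_sum, ← Finset.mul_sum, ← Finset.mul_sum, Finset.sum_add_distrib, hπ.2]
      unfold cleanProb at hi hk ⊢
      rw [hi, hk]
      ring
    simp only [cost, ← hedge, Finset.mul_sum]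
    rw [Finset.sum_comm]
    refine Finset.sum_congr rfl fun i _ => ?_
    rw [Finset.sum_comm]
    refine Finset.sum_congr rfl fun k _ => Finset.sum_congr rfl fun j _ => ?_
    ring
  have hs0 : ∀ i k, 0 ≤ cleanProb π {i, k} := fun i k =>
    Finset.sum_nonneg fun j _ => mul_nonneg (hπ.1 j) (by split_ifs <;> norm_num)
  have hs1 : ∀ i k, cleanProb π {i, k} ≤ f := by
    intro i k
    rw [← hf i]
    refine Finset.sum_le_sum fun j _ => mul_le_mul_of_nonneg_left ?_ (hπ.1 j)
    cases hi : j i <;> cases hk : j k <;> simp [hi, hk]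
  have hedges : 0 ≤ ∑ i, ∑ k ∈ Finset.Ioi i, a i k *
      (1 / 2 * f * ((1 / 2 + f) * (1 - ((z i : ℤ) : ℝ) * ((z k : ℤ) : ℝ)) + 1 / 2 *
        (1 - ((z i : ℤ) : ℝ) * ((z k : ℤ) : ℝ) * (1 - 4 * f + 4 * cleanProb π {i, k})))
      + (1 - f ^ 2) - (1 - cleanProb π {i, k} * (((z i : ℤ) : ℝ) * ((z k : ℤ) : ℝ)))) := by
    refine Finset.sum_nonneg fun i _ => Finset.sum_nonneg fun k _ => mul_nonneg (ha0 i k) ?_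
    have h1 := hs0 i k
    have h2 := hs1 i k
    generalize cleanProb π {i, k} = s at h1 h2 ⊢
    have h3 : ((z i : ℤ) : ℝ) * ((z k : ℤ) : ℝ) = 1 ∨ ((z i : ℤ) : ℝ) * ((z k : ℤ) : ℝ) = -1 := by
      rcases Int.units_eq_one_or (z i) with h | h <;>
        rcases Int.units_eq_one_or (z k) with h' | h' <;>
        simp [h, h']
    rcases h3 with h3 | h3 <;> rw [h3]
    · nlinarith [mul_nonneg h1 (sub_nonneg.mpr hf1)]
    · nlinarith [mul_nonneg (sub_nonneg.mpr h2) (sub_nonneg.mpr hf1)]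
  have hcomb : 1 / 2 * f * ((1 / 2 + f) * cost a z + 1 / 2 * ∑ j, π j * cost a (w j)) ≤
      1 / 2 * f * (1 + f) * maxCut a := by
    have h1 : (1 / 2 + f) * cost a z + 1 / 2 * ∑ j, π j * cost a (w j) ≤ (1 + f) * maxCut a := by
      nlinarith [hmax z, hw]
    calc _ ≤ 1 / 2 * f * ((1 + f) * maxCut a) := mul_le_mul_of_nonneg_left h1 (by positivity)
      _ = _ := by ring
  have hsplit : (1 / 2 : ℝ) * ∑ i, ∑ k ∈ Finset.Ioi i, a i k *
      (1 / 2 * f * ((1 / 2 + f) * (1 - ((z i : ℤ) : ℝ) * ((z k : ℤ) : ℝ)) + 1 / 2 *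
        (1 - ((z i : ℤ) : ℝ) * ((z k : ℤ) : ℝ) * (1 - 4 * f + 4 * cleanProb π {i, k})))
      + (1 - f ^ 2) - (1 - cleanProb π {i, k} * (((z i : ℤ) : ℝ) * ((z k : ℤ) : ℝ)))) =
      1 / 2 * f * ((1 / 2 + f) * cost a z + 1 / 2 * ∑ j, π j * cost a (w j))
      + (1 - f ^ 2) * avgCut a - 1 / 2 * ∑ i, ∑ k ∈ Finset.Ioi i,
        a i k * (1 - cleanProb π {i, k} * (((z i : ℤ) : ℝ) * ((z k : ℤ) : ℝ))) := by
    rw [hwsum, avgCut_eq, cost]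
    simp only [Finset.mul_sum, ← Finset.sum_add_distrib, ← Finset.sum_sub_distrib]
    refine Finset.sum_congr rfl fun i _ => Finset.sum_congr rfl fun k _ => ?_
    ring
  linarith

/-- The energy of a state after the averaged circuit, as an average over the measurement outcomes
of the computational basis. -/
lemma trace_costOp_mul_mixture {n : ℕ} (a : Matrix (Fin n) (Fin n) ℝ) {Φ : Op n → Op n}
    {π : (Fin n → Bool) → ℝ} (h : IsErrorLaw Φ π) {ρ : Op n} (hρ : ρ.PosSemidef) :
    (costOp a * Φ ρ).trace = ((∑ x, (ρ x x).re * (1 / 2 * ∑ i, ∑ k ∈ Finset.Ioi i,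
      a i k * (1 - cleanProb π {i, k} * (((((-1 : ℤˣ) ^ (x i : ℕ) : ℤˣ) : ℤ) : ℝ) *
        ((((-1 : ℤˣ) ^ (x k : ℕ) : ℤˣ) : ℤ) : ℝ)))) : ℝ) : ℂ) := by
  have hre : ∀ x, ρ x x = ((ρ x x).re : ℂ) := fun x =>
    (Complex.conj_eq_iff_re.mp (hρ.isHermitian.apply x x)).symm
  have hempty : cleanProb π ∅ = 1 := by simp [cleanProb, h.sum_eq_one]
  rw [trace_costOp_mul]
  simp only [zExp_mixture h, hempty, Complex.ofReal_one, one_mul]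
  rw [Complex.ofReal_sum]
  simp only [Complex.ofReal_mul, ← hre, Complex.ofReal_sum, Finset.mul_sum]
  rw [Finset.sum_comm]
  refine Finset.sum_congr rfl fun i _ => ?_
  rw [Finset.sum_comm]
  refine Finset.sum_congr rfl fun k hk => ?_
  have hik : i ≠ k := (Finset.mem_Ioi.mp hk).ne
  simp only [zExp, Finset.notMem_empty, if_false, Finset.prod_const_one, one_mul, Finset.mul_sum,
    ← Finset.sum_sub_distrib, Fintype.prod_ite_mem, Finset.prod_pair hik]
  refine Finset.sum_congr rfl fun x _ => ?_
  push_cast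
  ring

/-- Under translation invariance all qubits are clean with the same probability. -/
lemma cleanProb_singleton {n m : ℕ} {p : ℝ} {pre : Bool} {A : Architecture n m}
    (hA : TranslationInvariant A) (i k : Fin n) :
    cleanProb (avgLaw p pre A) {i} = cleanProb (avgLaw p pre A) {k} := by
  obtain ⟨g, hg, hmap⟩ := hA k i
  refine Fintype.sum_equiv (patternEquiv g) _ _ fun j => ?_
  simp only [Finset.mem_singleton, forall_eq, ← hg]
  congr 1
  exact (avgLaw_comp p pre hmap j).symm

lemma expectedErrors_eq {n : ℕ} {π : (Fin n → Bool) → ℝ} (hπ : ∑ j, π j = 1) :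
    expectedErrors π = ∑ i, (1 - cleanProb π {i}) := by
  have h : ∀ i, 1 - cleanProb π {i} = ∑ j, π j * if j i = true then 1 else 0 := by
    intro i
    refine (congrArg (· - cleanProb π {i}) hπ.symm).trans ?_
    rw [cleanProb, ← Finset.sum_sub_distrib]
    refine Finset.sum_congr rfl fun j _ => ?_
    cases h : j i <;> simp [h]
  simp only [h, expectedErrors, Finset.card_filter, Nat.cast_sum, Nat.cast_ite, Nat.cast_one,
    Nat.cast_zero, Finset.mul_sum]
  exact Finset.sum_comm

end NoisyEcho

theorem proposition1 {n m : ℕ}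
    (a : Matrix (Fin n) (Fin n) ℝ) (ha : a.IsSymm) (ha0 : ∀ i j, 0 ≤ a i j)
    (A : NoisyEcho.Architecture n m) (hA : NoisyEcho.TranslationInvariant A)
    (p : ℝ) (hp0 : 0 ≤ p) (hp1 : p ≤ 1) (pre : Bool) :
    (∃! π : (Fin n → Bool) → ℝ, NoisyEcho.IsErrorLaw (NoisyEcho.avgChannel p pre A) π) ∧
    ∀ π : (Fin n → Bool) → ℝ, NoisyEcho.IsErrorLaw (NoisyEcho.avgChannel p pre A) π →
      ∀ ρ : NoisyEcho.Op n, ρ.PosSemidef → ρ.trace = 1 →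
        (NoisyEcho.costOp a * NoisyEcho.avgChannel p pre A ρ).trace ≤
          ((1 / 2 * (1 - NoisyEcho.expectedErrors π / n) * (2 - NoisyEcho.expectedErrors π / n)
                * NoisyEcho.maxCut a
              + (1 - (1 - NoisyEcho.expectedErrors π / n) ^ 2) * NoisyEcho.avgCut a : ℝ) : ℂ) := by
  have hlaw := NoisyEcho.avgLaw_isErrorLaw hp0 hp1 pre A
  refine ⟨⟨_, hlaw, fun π hπ => NoisyEcho.errorLaw_unique hπ hlaw⟩, fun π hπ ρ hρ htr => ?_⟩
  set f := 1 - NoisyEcho.expectedErrors π / n with hfdef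
  have hprob : NoisyEcho.IsProbVector π := ⟨hπ.nonneg, hπ.sum_eq_one⟩
  have hclean : ∀ i, NoisyEcho.cleanProb π {i} = f := by
    intro i
    have hn : (n : ℝ) ≠ 0 := by
      have : 0 < n := i.pos
      positivity
    have h1 : NoisyEcho.expectedErrors π = n * (1 - NoisyEcho.cleanProb π {i}) := by
      rw [NoisyEcho.expectedErrors_eq hπ.sum_eq_one, NoisyEcho.errorLaw_unique hπ hlaw]
      simp only [NoisyEcho.cleanProb_singleton hA _ i, Finset.sum_const, Finset.card_univ,
        Fintype.card_fin, nsmul_eq_mul]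
    rw [hfdef, h1, mul_div_cancel_left₀ _ hn, sub_sub_cancel]
  have hf : 0 ≤ f ∧ f ≤ 1 := by
    rcases Nat.eq_zero_or_pos n with rfl | hn
    -- Without qubits the quotient by `n` is zero and `f = 1`.
    · simp [hfdef]
    · have i : Fin n := ⟨0, hn⟩
      rw [← hclean i]
      refine ⟨Finset.sum_nonneg fun j _ => mul_nonneg (hπ.nonneg j) (by split_ifs <;> norm_num), ?_⟩
      rw [← hπ.sum_eq_one]
      exact Finset.sum_le_sum fun j _ =>
        mul_le_of_le_one_right (hπ.nonneg j) (by split_ifs <;> norm_num)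
  have h2 : 2 - NoisyEcho.expectedErrors π / n = 1 + f := by rw [hfdef]; ring
  rw [h2, NoisyEcho.trace_costOp_mul_mixture a hπ hρ, Complex.real_le_real]
  have hsum : ∑ x, (ρ x x).re = 1 := by
    have := congrArg Complex.re htr
    simpa [Matrix.trace] using this
  calc _ ≤ ∑ x, (ρ x x).re * (1 / 2 * f * (1 + f) * NoisyEcho.maxCut a
        + (1 - f ^ 2) * NoisyEcho.avgCut a) :=
        Finset.sum_le_sum fun x _ => mul_le_mul_of_nonneg_left
          (NoisyEcho.cut_bound ha0 hprob hf.1 hf.2 hclean fun i => (-1) ^ (x i : ℕ))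
          (Complex.nonneg_iff.mp (hρ.diag_nonneg (i := x))).1
    _ = _ := by rw [← Finset.sum_mul, hsum, one_mul]
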